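/- Let $F$ be a field of characteristic $0$, $V$ a finite-dimensional $F$-vector space, $G\le \mathrm{GL}(V)$ a finite group generated by pseudo-reflections (elements whose fixed space has codimension one), $M$ a $G$-module over $F$ of finite dimension $r$, and $\chi\colon G\to F^\times$ a one-dimensional character. Let $S(V^*)$ be the symmetric algebra and $\wedge M^*$ the exterior algebra, with the contragredient $G$-action on $V^*$ and $M^*$ extended multiplicatively; for a $G$-module $W$ put $W^\chi=\{w\in W:\sigma w=\chi(\sigma)w\ \text{for all }\sigma\in G\}$. Bigrade $S(V^*)\otimes\wedge M^*$ by polynomial degree and exterior degree, and let $\mathcal J_M^*$ be its two-sided ideal generated by all homogeneous $G$-invariants of positive degree. The Hilbert series of a bigraded space $W=\bigoplus W_{i,j}$ is $\mathrm{Hilb}(W;q,z)=\sum_{i,j\ge 0} q^i z^j\dim W_{i,j}$. Let $\omega_1,\dots,\omega_r$ be basic derivations for $M^*$, i.e. a homogeneous basis of $(S(V^*)\otimes M)^G$ as an $S(V^*)^G$-module, with $\omega_i\in S^{e_i}(V^*)\otimes M$ (the $e_i=e_i^{M^*}$ are the $M^*$-exponents), and let $J_{M^*}\in S(V^*)$ be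 the determinant of the coefficients of the $\omega_i$ with respect to a basis of $M$. Let $\Delta_\chi$ be a nonzero homogeneous element of $S(V^*)$ with $S(V^*)^\chi=S(V^*)^G\Delta_\chi$. (1) If $J_{M^*}\mid\Delta_\chi$ and $M^G=0$, then $$\mathrm{Hilb}\big((S(V^*)\otimes\wedge M^*/\mathcal J_M^*)^\chi;q,z\big)=q^{\deg\Delta_\chi}\prod_{i=1}^r\big(1+zq^{-e_i^{M^*}}\big).$$ (2) Let $n\ge 1$, let $G=\mathfrak S_n$ act on $V=F^n$ by permutation matrices, and let $\chi=\mathrm{sgn}$. If $M$ is the standard $(n-1)$-dimensional representation (vectors in $F^n$ with coordinate sum zero), then $$\mathrm{Hilb}\big((S(V^*)\otimes\wedge M^*/\mathcal J_M^*)^{\mathrm{sgn}};q,z\big)=\prod_{i=1}^{n-1}(q^i+z).$$ The same product is the Hilbert series of the sign component of the super coinvariant algebra $F[x_1,\dots,x_n,\theta_1,\dots,\theta_n]/\mathcal J_n$, where the $x_i$ commute, the $\theta_i$ anticommute, $\mathfrak S_n$ permutes both sets of variables simultaneously, and $\mathcal J_n$ is generated by the homogeneous $\mathfrak S_n$-invariants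 of positive degree. -/

import Mathlib

open scoped TensorProduct

noncomputable section

namespace SuperCoinvariant

variable {F : Type*} [Field F] {G : Type*} [Group G]
  {V : Type*} [AddCommGroup V] [Module F V] {M : Type*} [AddCommGroup M] [Module F M]

/-! ### Reflection groups -/

/-- A pseudo-reflection of `V`: a linear map whose fixed space has codimension exactly one.
It is applied below only to the invertible maps `ρ g`. -/
def IsPseudoReflection (f : V →ₗ[F] V) : Prop :=
  Module.finrank F (LinearMap.ker (f - LinearMap.id)) + 1 = Module.finrank F V

/-- `ρ` identifies the finite group `G` with a pseudo-reflection group in `GL(V)`: it is faithful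
and the elements acting by pseudo-reflections generate `G`. -/
structure IsPseudoReflectionGroup (ρ : Representation F G V) : Prop where
  finite : Finite G
  faithful : Function.Injective ρ
  generated : Subgroup.closure {g : G | IsPseudoReflection (ρ g)} = ⊤

/-! ### Polynomial functions on `V` -/

variable (F V) in
/-- `S(V*)`, the algebra of polynomial functions on `V`. -/
abbrev Poly : Type _ := SymmetricAlgebra F (Module.Dual F V)

variable (F V) in
/-- The homogeneous component `S^d(V*)`: the span of the `d`-fold products of linear forms. -/
def polyPart (d : ℕ) : Submodule F (Poly F V) :=
  LinearMap.range (SymmetricAlgebra.ι F (Module.Dual F V)) ^ d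

/-- The action of `g` on `S(V*)`, the multiplicative extension of the contragredient action. -/
def polyAct (ρ : Representation F G V) (g : G) : Poly F V →ₐ[F] Poly F V :=
  SymmetricAlgebra.lift (SymmetricAlgebra.ι F (Module.Dual F V) ∘ₗ ρ.dual g)

/-- The ring of invariants `S(V*)^G`. -/
def polyInvariants (ρ : Representation F G V) : Subalgebra F (Poly F V) :=
  ⨅ g : G, AlgHom.equalizer (polyAct ρ g) (AlgHom.id F (Poly F V))

/-- `Δ` is a Vandermondian `Δ_χ`, and `d` is its degree: a nonzero element of `S^d(V*)` such that
`S(V*)^χ = S(V*)^G Δ`. -/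
structure IsVandermondian (ρ : Representation F G V) (χ : G →* Fˣ) (Δ : Poly F V) (d : ℕ) :
    Prop where
  ne_zero : Δ ≠ 0
  homogeneous : Δ ∈ polyPart F V d
  semiInvariants : ∀ f : Poly F V,
    (∀ g : G, polyAct ρ g f = (χ g : F) • f) ↔ ∃ h ∈ polyInvariants ρ, f = h * Δ

/-! ### Basic derivations and Jacobians -/

/-- `θ` is an invariant element of `S(V*) ⊗ N` under the diagonal action of `G`. -/
def IsInvariantTensor (ρ : Representation F G V) {N : Type*} [AddCommGroup N] [Module F N]
    (σ : Representation F G N) (θ : Poly F V ⊗[F] N) : Prop :=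
  ∀ g : G, TensorProduct.map (polyAct ρ g).toLinearMap (σ g) θ = θ

/-- `ω` is a family of basic derivations, with exponents `e`, for the dual module `N*`, that is, a
homogeneous basis of the `S(V*)^G`-module `(S(V*) ⊗ N**)^G = (S(V*) ⊗ N)^G`. So if `r = dim M`,
then `IsBasicDerivations ρ (σ : Representation F G M) (ω : Fin r → _) e` says that
`ω 0, …, ω (r - 1)` are basic derivations for `M*` and that the `e i` are the `M*`-exponents. -/
structure IsBasicDerivations (ρ : Representation F G V) {N : Type*} [AddCommGroup N] [Module F N]
    (σ : Representation F G N) {ι : Type*} [Fintype ι]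
    (ω : ι → Poly F V ⊗[F] N) (e : ι → ℕ) : Prop where
  homogeneous : ∀ i, ω i ∈ Submodule.map₂ (TensorProduct.mk F (Poly F V) N) (polyPart F V (e i)) ⊤
  invariant : ∀ i, IsInvariantTensor ρ σ (ω i)
  basis : ∀ θ, IsInvariantTensor ρ σ θ →
    ∃! c : ι → polyInvariants ρ, θ = ∑ i, (c i : Poly F V) • ω i

/-- The determinant of the coefficients of the family `ω` in `S(V*) ⊗ N` with respect to a basis
`b` of `N`. For basic derivations `ω` of `N*` this is the Jacobian `J_{N*}`. -/
def jacobian {N : Type*} [AddCommGroup N] [Module F N] {ι : Type*} [Fintype ι] [DecidableEq ι]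
    (b : Module.Basis ι F N) (ω : ι → Poly F V ⊗[F] N) : Poly F V :=
  Matrix.det (Matrix.of fun i j => (Algebra.TensorProduct.basis (Poly F V) b).repr (ω i) j)

/-! ### Differential forms and the super coinvariant algebra -/

variable (F V M) in
/-- The algebra `S(V*) ⊗ ⋀ M*`. -/
abbrev Forms : Type _ := Poly F V ⊗[F] ExteriorAlgebra F (Module.Dual F M)

variable (F V M) in
/-- The component `S^i(V*) ⊗ ⋀^j M*` of bidegree `(i, j)`. -/
def formsPart (i j : ℕ) : Submodule F (Forms F V M) :=
  Submodule.map₂ (TensorProduct.mk F (Poly F V) (ExteriorAlgebra F (Module.Dual F M)))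
    (polyPart F V i) (⋀[F]^j (Module.Dual F M))

/-- The diagonal action of `g` on `S(V*) ⊗ ⋀ M*`. -/
def formsAct (ρ : Representation F G V) (σ : Representation F G M) (g : G) :
    Forms F V M →ₐ[F] Forms F V M :=
  Algebra.TensorProduct.map (polyAct ρ g) (ExteriorAlgebra.map (σ.dual g))

/-- The two-sided ideal `J*_M` generated by the homogeneous invariants of positive degree. -/
def coinvariantIdeal (ρ : Representation F G V) (σ : Representation F G M) :
    TwoSidedIdeal (Forms F V M) :=
  TwoSidedIdeal.span {a | (∃ i j, 0 < i + j ∧ a ∈ formsPart F V M i j) ∧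
    ∀ g, formsAct ρ σ g a = a}

/-- The ideal `J*_M` as a linear subspace. -/
def coinvariantSubspace (ρ : Representation F G V) (σ : Representation F G M) :
    Submodule F (Forms F V M) :=
  (TwoSidedIdeal.asIdeal (coinvariantIdeal ρ σ)).restrictScalars F

theorem mem_coinvariantSubspace (ρ : Representation F G V) (σ : Representation F G M)
    (a : Forms F V M) : a ∈ coinvariantSubspace ρ σ ↔ a ∈ coinvariantIdeal ρ σ := by
  simp [coinvariantSubspace]

theorem coinvariantSubspace_le_comap (ρ : Representation F G V) (σ : Representation F G M)
    (g : G) :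
    coinvariantSubspace ρ σ ≤ (coinvariantSubspace ρ σ).comap (formsAct ρ σ g).toLinearMap := by
  have key : coinvariantIdeal ρ σ ≤ (coinvariantIdeal ρ σ).comap (formsAct ρ σ g) := by
    refine TwoSidedIdeal.span_le.2 fun a ha => ?_
    rw [SetLike.mem_coe, TwoSidedIdeal.mem_comap, ha.2 g]
    exact TwoSidedIdeal.subset_span ha
  intro a ha
  rw [Submodule.mem_comap, AlgHom.toLinearMap_apply, mem_coinvariantSubspace]
  exact (TwoSidedIdeal.mem_comap _).1 (key ((mem_coinvariantSubspace ρ σ a).1 ha))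

/-- The super coinvariant algebra `S(V*) ⊗ ⋀ M* / J*_M`, as a vector space. -/
abbrev Coinvariants (ρ : Representation F G V) (σ : Representation F G M) : Type _ :=
  Forms F V M ⧸ coinvariantSubspace ρ σ

/-- The action of `g` induced on the super coinvariant algebra. -/
def coinvariantsAct (ρ : Representation F G V) (σ : Representation F G M) (g : G) :
    Coinvariants ρ σ →ₗ[F] Coinvariants ρ σ :=
  Submodule.mapQ _ _ (formsAct ρ σ g).toLinearMap (coinvariantSubspace_le_comap ρ σ g)

/-- The component of bidegree `(i, j)` of the super coinvariant algebra. -/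
def coinvariantsPart (ρ : Representation F G V) (σ : Representation F G M) (i j : ℕ) :
    Submodule F (Coinvariants ρ σ) :=
  (formsPart F V M i j).map (coinvariantSubspace ρ σ).mkQ

/-- The `χ`-isotypic component `{w | g w = χ(g) w for all g}` of the super coinvariant algebra. -/
def coinvariantsSemi (ρ : Representation F G V) (σ : Representation F G M) (χ : G →* Fˣ) :
    Submodule F (Coinvariants ρ σ) :=
  ⨅ g : G, LinearMap.ker (coinvariantsAct ρ σ g - (χ g : F) • LinearMap.id)

/-! ### Hilbert series -/

/-- The ring `ℤ((q))[[z]]`, in which bigraded Hilbert series are compared. -/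
abbrev HilbRing : Type := PowerSeries (LaurentSeries ℤ)

/-- The element `q ^ k` of `ℤ((q))[[z]]`, for an integer `k`. -/
def qPow (k : ℤ) : HilbRing := PowerSeries.C (HahnSeries.single k (1 : ℤ))

/-- The variable `z` of `ℤ((q))[[z]]`. -/
def zVar : HilbRing := PowerSeries.X

/-- The bigraded Hilbert series `∑ q^i z^j dim W_{i,j}` of a subspace `W` of a space with
components `A i j`, where `W_{i,j}` is the intersection of `W` and `A i j`. -/
def hilbertSeries {N : Type*} [AddCommGroup N] [Module F N] (W : Submodule F N)
    (A : ℕ → ℕ → Submodule F N) : HilbRing :=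
  PowerSeries.mk fun j => HahnSeries.ofPowerSeries ℤ ℤ
    (PowerSeries.mk fun i => (Module.finrank F (W ⊓ A i j : Submodule F N) : ℤ))

/-- The bigraded Hilbert series of `(S(V*) ⊗ ⋀ M* / J*_M)^χ`. -/
def semiHilb (ρ : Representation F G V) (σ : Representation F G M) (χ : G →* Fˣ) : HilbRing :=
  hilbertSeries (coinvariantsSemi ρ σ χ) (coinvariantsPart ρ σ)

/-! ### The symmetric group -/

variable (F) in
/-- The action of the symmetric group on `F^n` by permutation matrices: `s` sends the basis
vector `e_i` to `e_{s i}`. -/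
def permRep (n : ℕ) : Representation F (Equiv.Perm (Fin n)) (Fin n → F) where
  toFun s := LinearMap.funLeft F F (s⁻¹ : Equiv.Perm (Fin n))
  map_one' := by ext; simp [LinearMap.funLeft_apply]
  map_mul' s t := by ext; simp [LinearMap.funLeft_apply]

variable (F) in
/-- The vectors in `F^n` with coordinate sum zero. -/
def sumZero (n : ℕ) : Submodule F (Fin n → F) :=
  LinearMap.ker (∑ i, LinearMap.proj i : (Fin n → F) →ₗ[F] F)

variable (F) in
theorem sumZero_le_comap (n : ℕ) (s : Equiv.Perm (Fin n)) :
    sumZero F n ≤ (sumZero F n).comap (permRep F n s) := by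
  intro v hv
  simp only [sumZero, Submodule.mem_comap, LinearMap.mem_ker, LinearMap.sum_apply,
    LinearMap.proj_apply] at hv ⊢
  rw [← hv]
  exact Equiv.sum_comp (s⁻¹ : Equiv.Perm (Fin n)) v

variable (F) in
/-- The standard `(n - 1)`-dimensional representation of the symmetric group. -/
def standardRep (n : ℕ) : Representation F (Equiv.Perm (Fin n)) (sumZero F n) :=
  (permRep F n).subrepresentation (sumZero F n) (sumZero_le_comap F n)

variable (F) in
/-- The sign character of the symmetric group, with values in `F`. -/
def signChar (n : ℕ) : Equiv.Perm (Fin n) →* Fˣ :=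
  (Units.map (Int.castRingHom F : ℤ →* F)).comp Equiv.Perm.sign

end SuperCoinvariant

end

/-!
The forms `S(V*) ⊗ ⋀ M*` are studied from the top exterior degree downwards, by contracting with the
invariant elements `ω_i` of `S(V*) ⊗ M`. Each contraction is an `S(V*)`-linear, `G`-equivariant
antiderivation, which raises the polynomial degree by `e_i` and lowers the exterior degree by one.

For a set `I` of indices let `coordForm ω I w` be the degree-zero part of the form obtained from `w`
by contracting with all `ω_i`, `i ∈ I`. If the Jacobian `J` of the `ω_i` is nonzero, a form is
determined by these coordinates (`eq_zero_of_coordForm`): by Cramer's rule, a form killed by all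
`ω_i` is killed by all of `M`, hence is a polynomial. When `J` divides `Δ`, contracting `Δ / J` times
the volume form by the `ω_i` with `i ∉ I` gives, up to sign, a form `β_I` whose only nonzero
coordinate is `Δ`, in position `I` (`exists_frame`); it has polynomial degree `deg Δ - ∑_{i ∈ I} e_i`
and exterior degree `|I|`. The coordinates of a `χ`-semi-invariant form are `χ`-semi-invariant
polynomials, that is, multiples of `Δ` by invariants. So the `β_I` are a basis of the semi-invariant
forms over `S(V*)^G`.

It remains to pass to the quotient. Averaging over `G` and supercommutation write a semi-invariant
element of the coinvariant ideal as a sum of products `w f`, with `w` semi-invariant and `f` a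
homogeneous invariant of positive degree. The antiderivation rule, applied along the list of
contractions, shows that the coordinates of `w f` are multiples of `Δ` by invariants without
constant term, as soon as the contractions used have positive degree
(`exists_extAug_contrList_of_mem`). If all `e_i` are positive, which is what `M^G = 0` ensures, the
classes of the `β_I` are therefore a basis of the semi-invariant coinvariants, and the Hilbert series
can be read off (`semiHilb_eq_of_jacobian_dvd`). If some `e_k` vanishes and the coinvariant ideal
contains a one-form `θ` dual to `ω_k`, then `β_I = θ * (contraction of β_I by ω_k)` lies in the ideal
for `k ∈ I`, and only the sets `I` avoiding such `k` contribute.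

For the symmetric group `Δ` is the Vandermonde determinant. On `F^n` one takes
`ω_k = ∑ (x_i^k - mean of the k-th powers) ⊗ e_i` for `0 < k < n` and `ω_0 = ∑ e_i`, whose Jacobian
is `Δ`; the mean of the `θ_i` is dual to `ω_0`. The `ω_k` with `k > 0` have values in the standard
representation, where their Jacobian is `Δ / n`.
-/

noncomputable section

namespace SuperCoinvariant

/-! ### Contractions of the exterior algebra -/

section Exterior

variable {F : Type*} [Field F] {N : Type*} [AddCommGroup N] [Module F N]

open CliffordAlgebra in
/-- Contraction is an antiderivation with respect to the grade involution. -/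
theorem contractLeft_mul (d : Module.Dual F N) (x y : ExteriorAlgebra F N) :
    contractLeft d (x * y) = contractLeft d x * y + involute x * contractLeft d y := by
  induction x using CliffordAlgebra.left_induction generalizing y with
  | algebraMap r => simp [contractLeft_algebraMap_mul]
  | add a b ha hb => simp only [add_mul, map_add, ha, hb]; abel
  | ι_mul a m ha =>
    rw [mul_assoc, contractLeft_ι_mul, ha, contractLeft_ι_mul, map_mul, involute_ι]
    simp only [sub_mul, mul_add, smul_mul_assoc, neg_mul, mul_assoc]
    abel

open CliffordAlgebra in
theorem ι_mul_eq_involute_mul (m : N) (b : ExteriorAlgebra F N) :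
    ExteriorAlgebra.ι F m * b = involute b * ExteriorAlgebra.ι F m := by
  induction b using CliffordAlgebra.left_induction with
  | algebraMap r => simp [Algebra.commutes]
  | add a b ha hb => simp only [mul_add, add_mul, map_add, ha, hb]
  | ι_mul a n ha =>
    rw [map_mul, involute_ι, mul_assoc, ← ha, ← mul_assoc, ← mul_assoc, neg_mul,
      eq_neg_of_add_eq_zero_left (ExteriorAlgebra.ι_add_mul_swap m n)]

open CliffordAlgebra in
/-- A form of degree `j` supercommutes with every form. -/
theorem mul_eq_iterate_involute_mul {j : ℕ} {f : ExteriorAlgebra F N} (hf : f ∈ ⋀[F]^j N)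
    (b : ExteriorAlgebra F N) : f * b = (⇑involute)^[j] b * f := by
  induction hf using Submodule.pow_induction_on_left' generalizing b with
  | algebraMap r => simp [Algebra.commutes]
  | add x y i hx hy h1 h2 => rw [add_mul, mul_add, h1, h2]
  | mem_mul m hm i x hx h =>
    obtain ⟨m, rfl⟩ := hm
    rw [mul_assoc, h, ← mul_assoc, ι_mul_eq_involute_mul, Function.iterate_succ_apply', mul_assoc]

open CliffordAlgebra in
theorem contractLeft_eq_zero_of_mem_zero (d : Module.Dual F N) {f : ExteriorAlgebra F N}
    (hf : f ∈ ⋀[F]^0 N) : contractLeft d f = 0 := by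
  obtain ⟨r, rfl⟩ : ∃ r, algebraMap F (ExteriorAlgebra F N) r = f := by
    simpa [ExteriorAlgebra.exteriorPower, Submodule.mem_one] using hf
  exact contractLeft_algebraMap _ d r

open CliffordAlgebra in
theorem contractLeft_mem (d : Module.Dual F N) {j : ℕ} {f : ExteriorAlgebra F N}
    (hf : f ∈ ⋀[F]^(j + 1) N) : contractLeft d f ∈ ⋀[F]^j N := by
  have key : ∀ k, ∀ f ∈ ⋀[F]^k N, ∀ j, k = j + 1 → contractLeft d f ∈ ⋀[F]^j N := by
    intro k f hf
    induction hf using Submodule.pow_induction_on_left' with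
    | algebraMap r => intro j hj; omega
    | add x y i hx hy h1 h2 =>
      intro j hj
      rw [map_add]
      exact add_mem (h1 j hj) (h2 j hj)
    | mem_mul m hm i x hx h =>
      intro j hj
      obtain rfl : i = j := by omega
      obtain ⟨m, rfl⟩ := hm
      rw [contractLeft_ι_mul]
      refine sub_mem (Submodule.smul_mem _ _ hx) ?_
      cases i with
      | zero => rw [contractLeft_eq_zero_of_mem_zero d hx, mul_zero]; exact zero_mem _
      | succ i =>
        have := h i rfl
        rw [ExteriorAlgebra.exteriorPower, pow_succ']
        exact Submodule.mul_mem_mul (LinearMap.mem_range_self _ m) this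
  exact key _ f hf j rfl

theorem algebraMapInv_eq_zero_of_mem {j : ℕ} {f : ExteriorAlgebra F N}
    (hf : f ∈ ⋀[F]^(j + 1) N) : ExteriorAlgebra.algebraMapInv f = 0 := by
  rw [ExteriorAlgebra.exteriorPower, pow_succ'] at hf
  induction hf using Submodule.mul_induction_on' with
  | mem_mul_mem a ha b hb =>
    obtain ⟨m, rfl⟩ := ha
    simp [ExteriorAlgebra.algebraMapInv]
  | add x _ y _ hx hy => rw [map_add, hx, hy, add_zero]

open CliffordAlgebra in
/-- Every form is the sum of its image under the substitution `β ↦ β - d(β) α` of one-forms and of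
`α` times its contraction by `d`. For `d α = 1` the substitution is the projection that eliminates
`α`. -/
theorem eq_map_add_ι_mul_contractLeft (d : Module.Dual F N) (α : N) (x : ExteriorAlgebra F N) :
    x = ExteriorAlgebra.map (LinearMap.id - d.smulRight α) x +
      ExteriorAlgebra.ι F α * contractLeft d x := by
  induction x using CliffordAlgebra.left_induction with
  | algebraMap r =>
    rw [contractLeft_algebraMap, mul_zero, add_zero]
    exact (AlgHom.commutes _ r).symm
  | add a b ha hb =>
    rw [map_add, map_add, mul_add]
    nth_rewrite 1 [ha, hb]
    abel
  | ι_mul y a hy =>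
    have h1 : ExteriorAlgebra.ι F α * (ExteriorAlgebra.ι F a * contractLeft d y) =
        - (ExteriorAlgebra.ι F a * (ExteriorAlgebra.ι F α * contractLeft d y)) := by
      rw [← mul_assoc, ← mul_assoc, ← neg_mul,
        eq_neg_of_add_eq_zero_left (ExteriorAlgebra.ι_add_mul_swap α a)]
    have h2 : ExteriorAlgebra.ι F α * y = ExteriorAlgebra.ι F α *
        ExteriorAlgebra.map (LinearMap.id - d.smulRight α) y := by
      nth_rewrite 1 [hy]
      rw [mul_add, ← mul_assoc, ExteriorAlgebra.ι_sq_zero, zero_mul, add_zero]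
    rw [contractLeft_ι_mul, map_mul, ExteriorAlgebra.map_apply_ι, mul_sub, h1, mul_smul_comm, h2]
    simp only [LinearMap.sub_apply, LinearMap.id_apply, LinearMap.smulRight_apply, map_sub,
      map_smul, sub_mul, smul_mul_assoc]
    nth_rewrite 1 [hy]
    rw [mul_add]
    abel

theorem map_zero_apply (x : ExteriorAlgebra F N) :
    ExteriorAlgebra.map (0 : N →ₗ[F] N) x = algebraMap F _ (ExteriorAlgebra.algebraMapInv x) := by
  have : ExteriorAlgebra.map (0 : N →ₗ[F] N) =
      (Algebra.ofId F _).comp ExteriorAlgebra.algebraMapInv := by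
    ext m
    simp [ExteriorAlgebra.algebraMapInv]
  rw [this]; rfl

end Exterior

/-! ### Contractions of forms with polynomial coefficients -/

variable {F : Type*} [Field F] {G : Type*} [Group G]
  {V : Type*} [AddCommGroup V] [Module F V] {M : Type*} [AddCommGroup M] [Module F M]

variable (F V M) in
/-- The projection `S(V*) ⊗ ⋀ M* → S(V*)` onto the component of exterior degree zero. -/
def extAug : Forms F V M →ₐ[Poly F V] Poly F V :=
  (Algebra.TensorProduct.rid F (Poly F V) (Poly F V)).toAlgHom.comp
    (Algebra.TensorProduct.map (AlgHom.id (Poly F V) (Poly F V)) ExteriorAlgebra.algebraMapInv)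

@[simp] theorem extAug_tmul (p : Poly F V) (w : ExteriorAlgebra F (Module.Dual F M)) :
    extAug F V M (p ⊗ₜ w) = ExteriorAlgebra.algebraMapInv w • p := by
  simp [extAug]

variable (F V M) in
/-- The grade involution of `S(V*) ⊗ ⋀ M*`, equal to `(-1)^j` on exterior degree `j`. -/
def gradeInv : Forms F V M →ₐ[Poly F V] Forms F V M :=
  Algebra.TensorProduct.map (AlgHom.id (Poly F V) (Poly F V)) CliffordAlgebra.involute

@[simp] theorem gradeInv_tmul (p : Poly F V) (w : ExteriorAlgebra F (Module.Dual F M)) :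
    gradeInv F V M (p ⊗ₜ w) = p ⊗ₜ CliffordAlgebra.involute w := by
  simp [gradeInv]

/-- The contraction of `S(V*) ⊗ ⋀ M*` by an element of `S(V*) ⊗ M`; it is `S(V*)`-linear in both
arguments. -/
def contr : Poly F V ⊗[F] M →ₗ[Poly F V] Module.End (Poly F V) (Forms F V M) :=
  LinearMap.liftBaseChange (Poly F V) (LinearMap.baseChangeHom F (Poly F V) _ _ ∘ₗ
    (CliffordAlgebra.contractLeft (Q := (0 : QuadraticForm F (Module.Dual F M)))) ∘ₗ
      Module.Dual.eval F M)

@[simp] theorem contr_tmul (p s : Poly F V) (m : M) (w : ExteriorAlgebra F (Module.Dual F M)) :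
    contr (p ⊗ₜ[F] m) (s ⊗ₜ w) =
      (p * s) ⊗ₜ CliffordAlgebra.contractLeft (Module.Dual.eval F M m) w := by
  simp [contr, TensorProduct.smul_tmul']

theorem contr_mul (θ : Poly F V ⊗[F] M) (a b : Forms F V M) :
    contr θ (a * b) = contr θ a * b + gradeInv F V M a * contr θ b := by
  induction θ using TensorProduct.induction_on with
  | zero => simp
  | add x y hx hy => simp only [map_add, LinearMap.add_apply, hx, hy, add_mul, mul_add]; abel
  | tmul p m =>
    induction a using TensorProduct.induction_on with
    | zero => simp
    | add x y hx hy => simp only [map_add, hx, hy, add_mul]; abel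
    | tmul s w =>
      induction b using TensorProduct.induction_on with
      | zero => simp
      | add x y hx hy => simp only [map_add, hx, hy, mul_add]; abel
      | tmul t u =>
        simp only [Algebra.TensorProduct.tmul_mul_tmul, contr_tmul, gradeInv_tmul,
          contractLeft_mul, TensorProduct.tmul_add]
        congr 2 <;> ring

theorem contr_contr_comm (θ η : Poly F V ⊗[F] M) (a : Forms F V M) :
    contr θ (contr η a) = - contr η (contr θ a) := by
  induction θ using TensorProduct.induction_on with
  | zero => simp
  | add x y hx hy => simp only [map_add, LinearMap.add_apply, hx, hy]; abel
  | tmul p m =>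
    induction η using TensorProduct.induction_on with
    | zero => simp
    | add x y hx hy => simp only [map_add, LinearMap.add_apply, hx, hy]; abel
    | tmul q n =>
      induction a using TensorProduct.induction_on with
      | zero => simp
      | add x y hx hy => simp only [map_add, hx, hy]; abel
      | tmul t u =>
        simp only [contr_tmul]
        rw [CliffordAlgebra.contractLeft_comm, TensorProduct.tmul_neg, mul_left_comm]

theorem contr_contr_self (θ : Poly F V ⊗[F] M) (a : Forms F V M) :
    contr θ (contr θ a) = 0 := by
  induction θ using TensorProduct.induction_on with
  | zero => simp
  | add x y hx hy =>
    simp only [map_add, LinearMap.add_apply, hx, hy, contr_contr_comm x y]; abel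
  | tmul p m =>
    induction a using TensorProduct.induction_on with
    | zero => simp
    | add x y hx hy => simp only [map_add, hx, hy]; abel
    | tmul t u => simp [CliffordAlgebra.contractLeft_contractLeft]

/-! ### Degrees -/

theorem formsPart_le {i j : ℕ} {P : Submodule F (Forms F V M)}
    (h : ∀ p ∈ polyPart F V i, ∀ w ∈ ⋀[F]^j (Module.Dual F M), p ⊗ₜ w ∈ P) :
    formsPart F V M i j ≤ P :=
  Submodule.map₂_le.2 h

theorem tmul_mem_formsPart {i j : ℕ} {p : Poly F V} (hp : p ∈ polyPart F V i)
    {w : ExteriorAlgebra F (Module.Dual F M)} (hw : w ∈ ⋀[F]^j (Module.Dual F M)) :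
    p ⊗ₜ w ∈ formsPart F V M i j :=
  Submodule.apply_mem_map₂ _ hp hw

theorem mul_mem_polyPart {i j : ℕ} {p q : Poly F V} (hp : p ∈ polyPart F V i)
    (hq : q ∈ polyPart F V j) : p * q ∈ polyPart F V (i + j) := by
  rw [polyPart, pow_add]; exact Submodule.mul_mem_mul hp hq

theorem smul_mem_formsPart {i j k : ℕ} {p : Poly F V} (hp : p ∈ polyPart F V k)
    {a : Forms F V M} (ha : a ∈ formsPart F V M i j) : p • a ∈ formsPart F V M (k + i) j := by
  suffices h : formsPart F V M i j ≤ (formsPart F V M (k + i) j).comap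
      ((LinearMap.lsmul (Poly F V) (Forms F V M) p).restrictScalars F) from h ha
  refine formsPart_le fun q hq w hw => ?_
  simpa [TensorProduct.smul_tmul'] using tmul_mem_formsPart (mul_mem_polyPart hp hq) hw

/-- The component `S^e(V*) ⊗ M` of `S(V*) ⊗ M`. -/
abbrev derPart (F V M : Type*) [Field F] [AddCommGroup V] [Module F V] [AddCommGroup M]
    [Module F M] (e : ℕ) : Submodule F (Poly F V ⊗[F] M) :=
  Submodule.map₂ (TensorProduct.mk F (Poly F V) M) (polyPart F V e) ⊤

theorem contr_mem_formsPart {e i j : ℕ} {θ : Poly F V ⊗[F] M} (hθ : θ ∈ derPart F V M e)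
    {a : Forms F V M} (ha : a ∈ formsPart F V M i (j + 1)) :
    contr θ a ∈ formsPart F V M (e + i) j := by
  suffices h : derPart F V M e ≤ (formsPart F V M (e + i) j).comap
      ((LinearMap.applyₗ a).restrictScalars F ∘ₗ contr.restrictScalars F) from h hθ
  refine Submodule.map₂_le.2 fun p hp m _ => ?_
  suffices h : formsPart F V M i (j + 1) ≤ (formsPart F V M (e + i) j).comap
      ((contr (p ⊗ₜ[F] m)).restrictScalars F) from h ha
  refine formsPart_le fun q hq w hw => ?_
  simpa using tmul_mem_formsPart (mul_mem_polyPart hp hq)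
    (contractLeft_mem (Module.Dual.eval F M m) hw)

theorem contr_eq_zero_of_mem_formsPart_zero (θ : Poly F V ⊗[F] M) {i : ℕ}
    {a : Forms F V M} (ha : a ∈ formsPart F V M i 0) : contr θ a = 0 := by
  suffices h : formsPart F V M i 0 ≤ LinearMap.ker ((contr θ).restrictScalars F) from h ha
  refine formsPart_le fun q hq w hw => ?_
  change contr θ (q ⊗ₜ w) = 0
  induction θ using TensorProduct.induction_on with
  | zero => simp
  | add x y hx hy => simp only [map_add, LinearMap.add_apply, hx, hy, add_zero]
  | tmul p m => rw [contr_tmul, contractLeft_eq_zero_of_mem_zero _ hw, TensorProduct.tmul_zero]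

theorem extAug_mem_polyPart {i j : ℕ} {a : Forms F V M} (ha : a ∈ formsPart F V M i j) :
    extAug F V M a ∈ polyPart F V i := by
  suffices h : formsPart F V M i j ≤ (polyPart F V i).comap
      ((extAug F V M).toLinearMap.restrictScalars F) from h ha
  refine formsPart_le fun q hq w hw => ?_
  simpa using Submodule.smul_mem _ _ hq

theorem extAug_eq_zero {i j : ℕ} {a : Forms F V M} (ha : a ∈ formsPart F V M i (j + 1)) :
    extAug F V M a = 0 := by
  suffices h : formsPart F V M i (j + 1) ≤
      LinearMap.ker ((extAug F V M).toLinearMap.restrictScalars F) from h ha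
  refine formsPart_le fun q hq w hw => ?_
  simp [algebraMapInv_eq_zero_of_mem hw]

theorem gradeInv_iterate_tmul (j : ℕ) (p : Poly F V) (w : ExteriorAlgebra F (Module.Dual F M)) :
    (⇑(gradeInv F V M))^[j] (p ⊗ₜ w) = p ⊗ₜ (⇑CliffordAlgebra.involute)^[j] w := by
  induction j generalizing w with
  | zero => rfl
  | succ j ih => simp [Function.iterate_succ_apply, ih]

/-- Forms of pure exterior degree supercommute with all forms, so that they generate the same
left and two-sided ideals. -/
theorem mul_eq_iterate_gradeInv_mul {i j : ℕ} {f : Forms F V M} (hf : f ∈ formsPart F V M i j)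
    (b : Forms F V M) : f * b = (⇑(gradeInv F V M))^[j] b * f := by
  have hadd : ∀ x y, (⇑(gradeInv F V M))^[j] (x + y) =
      (⇑(gradeInv F V M))^[j] x + (⇑(gradeInv F V M))^[j] y := fun x y =>
    iterate_map_add _ _ _ _
  have hzero : (⇑(gradeInv F V M))^[j] 0 = 0 := iterate_map_zero _ _
  suffices h : formsPart F V M i j ≤ LinearMap.ker (LinearMap.mulRight F b -
      LinearMap.mulLeft F ((⇑(gradeInv F V M))^[j] b)) by
    simpa [sub_eq_zero] using h hf
  refine formsPart_le fun q hq w hw => ?_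
  rw [LinearMap.mem_ker, LinearMap.sub_apply, sub_eq_zero]
  change q ⊗ₜ w * b = (⇑(gradeInv F V M))^[j] b * q ⊗ₜ w
  induction b using TensorProduct.induction_on with
  | zero => rw [hzero]; simp
  | add x y hx hy => rw [hadd, mul_add, add_mul, hx, hy]
  | tmul p u =>
    rw [gradeInv_iterate_tmul, Algebra.TensorProduct.tmul_mul_tmul,
      Algebra.TensorProduct.tmul_mul_tmul, mul_comm, mul_eq_iterate_involute_mul hw]

/-! ### Equivariance -/

section Equivariance

variable (ρ : Representation F G V) (σ : Representation F G M)

@[simp] theorem polyAct_ι (g : G) (α : Module.Dual F V) :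
    polyAct ρ g (SymmetricAlgebra.ι F _ α) = SymmetricAlgebra.ι F _ (ρ.dual g α) := by
  simp [polyAct]

@[simp] theorem formsAct_tmul (g : G) (p : Poly F V) (w : ExteriorAlgebra F (Module.Dual F M)) :
    formsAct ρ σ g (p ⊗ₜ w) = polyAct ρ g p ⊗ₜ ExteriorAlgebra.map (σ.dual g) w := by
  simp [formsAct]

theorem formsAct_smul (g : G) (p : Poly F V) (a : Forms F V M) :
    formsAct ρ σ g (p • a) = polyAct ρ g p • formsAct ρ σ g a := by
  induction a using TensorProduct.induction_on with
  | zero => simp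
  | add x y hx hy => simp only [smul_add, map_add, hx, hy]
  | tmul s w => simp [TensorProduct.smul_tmul']

theorem polyAct_mul_apply (g h : G) (p : Poly F V) :
    polyAct ρ (g * h) p = polyAct ρ g (polyAct ρ h p) := by
  suffices H : polyAct ρ (g * h) = (polyAct ρ g).comp (polyAct ρ h) by rw [H]; rfl
  refine SymmetricAlgebra.algHom_ext (LinearMap.ext fun α => ?_)
  change polyAct ρ (g * h) (SymmetricAlgebra.ι F _ α) =
    polyAct ρ g (polyAct ρ h (SymmetricAlgebra.ι F _ α))
  simp only [polyAct_ι, map_mul, Module.End.mul_apply]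

theorem map_dual_mul_apply (g h : G) (w : ExteriorAlgebra F (Module.Dual F M)) :
    ExteriorAlgebra.map (σ.dual (g * h)) w =
      ExteriorAlgebra.map (σ.dual g) (ExteriorAlgebra.map (σ.dual h) w) := by
  rw [← AlgHom.comp_apply, ExteriorAlgebra.map_comp_map, map_mul]; rfl

theorem formsAct_mul_apply (g h : G) (a : Forms F V M) :
    formsAct ρ σ (g * h) a = formsAct ρ σ g (formsAct ρ σ h a) := by
  induction a using TensorProduct.induction_on with
  | zero => simp
  | add x y hx hy => simp only [map_add, hx, hy]
  | tmul p w => simp only [formsAct_tmul, polyAct_mul_apply, map_dual_mul_apply]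

theorem formsAct_gradeInv (g : G) (a : Forms F V M) :
    formsAct ρ σ g (gradeInv F V M a) = gradeInv F V M (formsAct ρ σ g a) := by
  induction a using TensorProduct.induction_on with
  | zero => simp
  | add x y hx hy => simp only [map_add, hx, hy]
  | tmul p w =>
    simp only [formsAct_tmul, gradeInv_tmul]
    congr 1
    suffices H : (ExteriorAlgebra.map (σ.dual g)).comp CliffordAlgebra.involute =
        (CliffordAlgebra.involute).comp (ExteriorAlgebra.map (σ.dual g)) from
      DFunLike.congr_fun H w
    refine ExteriorAlgebra.hom_ext (LinearMap.ext fun m => ?_)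
    have h1 := CliffordAlgebra.involute_ι (Q := (0 : QuadraticForm F (Module.Dual F M))) m
    have h2 := CliffordAlgebra.involute_ι (Q := (0 : QuadraticForm F (Module.Dual F M)))
      (σ.dual g m)
    have h3 := ExteriorAlgebra.map_apply_ι (σ.dual g) m
    simp only [LinearMap.comp_apply, AlgHom.toLinearMap_apply, AlgHom.comp_apply]
    rw [h1, h3, h2, map_neg, h3]

theorem extAug_formsAct (g : G) (a : Forms F V M) :
    extAug F V M (formsAct ρ σ g a) = polyAct ρ g (extAug F V M a) := by
  induction a using TensorProduct.induction_on with
  | zero => simp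
  | add x y hx hy => simp only [map_add, hx, hy]
  | tmul p w =>
    simp only [formsAct_tmul, extAug_tmul, map_smul]
    congr 1
    suffices H : (ExteriorAlgebra.algebraMapInv).comp (ExteriorAlgebra.map (σ.dual g)) =
        ExteriorAlgebra.algebraMapInv from DFunLike.congr_fun H w
    refine ExteriorAlgebra.hom_ext (LinearMap.ext fun m => ?_)
    simp [ExteriorAlgebra.algebraMapInv]

theorem map_dual_contractLeft (g : G) (m : M) (w : ExteriorAlgebra F (Module.Dual F M)) :
    ExteriorAlgebra.map (σ.dual g) (CliffordAlgebra.contractLeft (Module.Dual.eval F M m) w) =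
      CliffordAlgebra.contractLeft (Module.Dual.eval F M (σ g m))
        (ExteriorAlgebra.map (σ.dual g) w) := by
  induction w using CliffordAlgebra.left_induction with
  | algebraMap r =>
    rw [CliffordAlgebra.contractLeft_algebraMap, map_zero]
    erw [AlgHom.commutes, CliffordAlgebra.contractLeft_algebraMap]
  | add a b ha hb => simp only [map_add, ha, hb]
  | ι_mul y a hy =>
    rw [CliffordAlgebra.contractLeft_ι_mul, map_sub, map_mul, map_mul, hy, map_smul,
      ExteriorAlgebra.map_apply_ι, CliffordAlgebra.contractLeft_ι_mul]
    congr 2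
    simp [Module.Dual.transpose_apply]

theorem formsAct_contr (g : G) (θ : Poly F V ⊗[F] M) (a : Forms F V M) :
    formsAct ρ σ g (contr θ a) =
      contr (TensorProduct.map (polyAct ρ g).toLinearMap (σ g) θ) (formsAct ρ σ g a) := by
  induction θ using TensorProduct.induction_on with
  | zero => simp
  | add x y hx hy => simp only [map_add, LinearMap.add_apply, hx, hy]
  | tmul p m =>
    induction a using TensorProduct.induction_on with
    | zero => simp
    | add x y hx hy => simp only [map_add, hx, hy]
    | tmul s w =>
      simp only [contr_tmul, formsAct_tmul, map_mul, map_dual_contractLeft, TensorProduct.map_tmul,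
        AlgHom.toLinearMap_apply]

theorem formsAct_mem_formsPart (g : G) {i j : ℕ} {a : Forms F V M}
    (ha : a ∈ formsPart F V M i j) : formsAct ρ σ g a ∈ formsPart F V M i j := by
  suffices h : formsPart F V M i j ≤
      (formsPart F V M i j).comap (formsAct ρ σ g).toLinearMap from h ha
  refine formsPart_le fun p hp w hw => ?_
  simp only [Submodule.mem_comap, AlgHom.toLinearMap_apply, formsAct_tmul]
  refine tmul_mem_formsPart ?_ ?_
  · have := Submodule.mem_map_of_mem (f := (polyAct ρ g).toLinearMap) hp
    rw [polyPart, Submodule.map_pow] at this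
    refine SetLike.le_def.1 (pow_le_pow_left' ?_ i) this
    rintro _ ⟨_, ⟨α, rfl⟩, rfl⟩
    simp
  · have := Submodule.mem_map_of_mem (f := (ExteriorAlgebra.map (σ.dual g)).toLinearMap) hw
    rw [ExteriorAlgebra.exteriorPower, Submodule.map_pow] at this
    refine SetLike.le_def.1 (pow_le_pow_left' ?_ j) this
    rintro _ ⟨_, ⟨α, rfl⟩, rfl⟩
    simp

end Equivariance

/-! ### The grading of `S(V*)` -/

variable (F V) in
/-- The homomorphism `S(V*) → S(V*)[t]` sending a linear form `α` to `α t`; its coefficients are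
the homogeneous components. -/
def gradingHom : Poly F V →ₐ[F] Polynomial (Poly F V) :=
  SymmetricAlgebra.lift ((LinearMap.mulRight F Polynomial.X) ∘ₗ
    (Polynomial.CAlgHom (R := F) (A := Poly F V)).toLinearMap ∘ₗ
      SymmetricAlgebra.ι F (Module.Dual F V))

@[simp] theorem gradingHom_ι (α : Module.Dual F V) :
    gradingHom F V (SymmetricAlgebra.ι F _ α) =
      Polynomial.C (SymmetricAlgebra.ι F _ α) * Polynomial.X := by
  simp [gradingHom]

theorem gradingHom_of_mem {i : ℕ} {p : Poly F V} (hp : p ∈ polyPart F V i) :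
    gradingHom F V p = Polynomial.C p * Polynomial.X ^ i := by
  rw [polyPart] at hp
  induction hp using Submodule.pow_induction_on_left' with
  | algebraMap r => simp [Polynomial.algebraMap_apply]
  | add x y i hx hy h1 h2 => rw [map_add, h1, h2, Polynomial.C_add, add_mul]
  | mem_mul m hm i x hx h =>
    obtain ⟨α, rfl⟩ := hm
    rw [map_mul, h, gradingHom_ι, Polynomial.C_mul, pow_succ']
    ring

theorem coeff_gradingHom_mem (p : Poly F V) (i : ℕ) :
    (gradingHom F V p).coeff i ∈ polyPart F V i := by
  induction p using SymmetricAlgebra.induction generalizing i with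
  | algebraMap r =>
    rw [AlgHom.commutes, Polynomial.algebraMap_apply, Polynomial.coeff_C]
    split_ifs with h
    · subst h
      rw [polyPart, pow_zero]
      exact Submodule.algebraMap_mem r
    · exact zero_mem _
  | ι α =>
    rw [gradingHom_ι, Polynomial.coeff_C_mul, Polynomial.coeff_X]
    split_ifs with h
    · subst h
      rw [polyPart, pow_one, mul_one]
      exact LinearMap.mem_range_self _ α
    · rw [mul_zero]; exact zero_mem _
  | mul a b ha hb =>
    rw [map_mul, Polynomial.coeff_mul]
    refine Submodule.sum_mem _ fun x hx => ?_
    rw [← Finset.HasAntidiagonal.mem_antidiagonal.1 hx]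
    exact mul_mem_polyPart (ha _) (hb _)
  | add a b ha hb =>
    rw [map_add, Polynomial.coeff_add]
    exact add_mem (ha _) (hb _)

theorem eval_one_gradingHom (p : Poly F V) : (gradingHom F V p).eval 1 = p := by
  suffices H : ((Polynomial.aeval (1 : Poly F V)).restrictScalars F).comp (gradingHom F V) =
      AlgHom.id F _ by
    simpa [Polynomial.aeval_def, Polynomial.eval₂_eq_eval_map] using DFunLike.congr_fun H p
  refine SymmetricAlgebra.algHom_ext (LinearMap.ext fun α => ?_)
  change Polynomial.aeval (1 : Poly F V) (gradingHom F V (SymmetricAlgebra.ι F _ α)) =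
    SymmetricAlgebra.ι F _ α
  simp

theorem coeff_zero_gradingHom (p : Poly F V) :
    (gradingHom F V p).coeff 0 = algebraMap F _ (SymmetricAlgebra.algebraMapInv p) := by
  suffices H : ((Polynomial.aeval (0 : Poly F V)).restrictScalars F).comp (gradingHom F V) =
      (Algebra.ofId F _).comp SymmetricAlgebra.algebraMapInv by
    have := DFunLike.congr_fun H p
    simpa [Polynomial.aeval_def, Polynomial.eval₂_eq_eval_map, Polynomial.coeff_zero_eq_eval_zero]
      using this
  refine SymmetricAlgebra.algHom_ext (LinearMap.ext fun α => ?_)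
  change Polynomial.aeval (0 : Poly F V) (gradingHom F V (SymmetricAlgebra.ι F _ α)) =
    algebraMap F _ (SymmetricAlgebra.algebraMapInv (SymmetricAlgebra.ι F _ α))
  simp [SymmetricAlgebra.algebraMapInv_ι]

theorem algebraMapInv_eq_zero_of_mem_polyPart {i : ℕ} (hi : 0 < i) {p : Poly F V}
    (hp : p ∈ polyPart F V i) : SymmetricAlgebra.algebraMapInv p = 0 := by
  have h := coeff_zero_gradingHom p
  rw [gradingHom_of_mem hp, Polynomial.coeff_C_mul, Polynomial.coeff_X_pow, if_neg hi.ne,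
    mul_zero] at h
  exact (SymmetricAlgebra.algebraMap_eq_zero_iff _ _).1 h.symm

/-- If a nonzero homogeneous element is the product of a homogeneous element and `p`, then `p` is
homogeneous. -/
theorem exists_mem_polyPart_of_mul_eq {d s : ℕ} {J p Δ : Poly F V} (hΔ0 : Δ ≠ 0)
    (hΔ : Δ ∈ polyPart F V d) (hJ : J ∈ polyPart F V s) (h : Δ = J * p) :
    ∃ k, k + s = d ∧ p ∈ polyPart F V k := by
  have hJ0 : J ≠ 0 := by rintro rfl; simp [hΔ0] at h
  have key : Polynomial.C Δ * Polynomial.X ^ d =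
      Polynomial.C J * Polynomial.X ^ s * gradingHom F V p := by
    rw [← gradingHom_of_mem hΔ, ← gradingHom_of_mem hJ, ← map_mul, h]
  have hc : ∀ n, (gradingHom F V p).coeff n = if n + s = d then p else 0 := by
    intro n
    have := congrArg (fun q => Polynomial.coeff q (n + s)) key
    simp only [Polynomial.coeff_C_mul, Polynomial.coeff_X_pow, mul_assoc] at this
    rw [Polynomial.coeff_X_pow_mul] at this
    refine mul_left_cancel₀ hJ0 (this.symm.trans ?_)
    split_ifs
    · rw [mul_one, h]
    · simp
  have hsd : s ≤ d := by
    by_contra hlt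
    have : gradingHom F V p = 0 := by
      ext n
      rw [hc, if_neg (by omega), Polynomial.coeff_zero]
    have hp := eval_one_gradingHom p
    rw [this, Polynomial.eval_zero] at hp
    exact hΔ0 (by rw [h, ← hp, mul_zero])
  refine ⟨d - s, by omega, ?_⟩
  have := coeff_gradingHom_mem p (d - s)
  rwa [hc, if_pos (by omega)] at this

/-! ### Iterated contractions -/

section Lists

variable {ι : Type*}

/-- The composite of the contractions by `ω i`, for `i` running through a list. -/
def contrList (ω : ι → Poly F V ⊗[F] M) (l : List ι) : Module.End (Poly F V) (Forms F V M) :=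
  (l.map fun i => contr (ω i)).prod

variable (ω : ι → Poly F V ⊗[F] M)

@[simp] theorem contrList_nil (a : Forms F V M) : contrList ω [] a = a := by simp [contrList]

@[simp] theorem contrList_cons (i : ι) (l : List ι) (a : Forms F V M) :
    contrList ω (i :: l) a = contr (ω i) (contrList ω l a) := by simp [contrList]

theorem contrList_append (l l' : List ι) (a : Forms F V M) :
    contrList ω (l ++ l') a = contrList ω l (contrList ω l' a) := by simp [contrList]

theorem contrList_perm {l l' : List ι} (h : l.Perm l') :
    (∀ a, contrList ω l a = contrList ω l' a) ∨ ∀ a, contrList ω l a = - contrList ω l' a := by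
  induction h with
  | nil => exact Or.inl fun _ => rfl
  | cons x _ ih => exact ih.imp (fun h a => by simp [h]) fun h a => by simp [h]
  | swap x y l => exact Or.inr fun a => by simpa using contr_contr_comm _ _ _
  | trans _ _ h1 h2 => rcases h1 with h1 | h1 <;> rcases h2 with h2 | h2 <;> simp [h1, h2]

theorem contrList_eq_zero {l : List ι} (h : ¬ l.Nodup) (a : Forms F V M) :
    contrList ω l a = 0 := by
  classical
  obtain ⟨x, hx⟩ : ∃ x, List.Duplicate x l := by
    by_contra hc
    exact h (List.nodup_iff_forall_not_duplicate.2 fun x hx => hc ⟨x, hx⟩)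
  have h2 : x ∈ l.erase x := by
    rw [← List.count_pos_iff, List.count_erase_self]
    have := List.duplicate_iff_two_le_count.1 hx
    omega
  have hp : l.Perm (x :: x :: (l.erase x).erase x) :=
    (List.perm_cons_erase hx.mem).trans ((List.perm_cons_erase h2).cons x)
  have h0 : contrList ω (x :: x :: (l.erase x).erase x) a = 0 := by
    simpa using contr_contr_self _ _
  rcases contrList_perm ω hp with h | h <;> simp [h, h0]

theorem contrList_mem_formsPart {e : ι → ℕ} (hω : ∀ i, ω i ∈ derPart F V M (e i)) (l : List ι)
    {i j : ℕ} {a : Forms F V M} (ha : a ∈ formsPart F V M i (j + l.length)) :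
    contrList ω l a ∈ formsPart F V M ((l.map e).sum + i) j := by
  induction l generalizing j with
  | nil => simpa using ha
  | cons k l ih =>
    rw [contrList_cons, List.map_cons, List.sum_cons, add_assoc]
    refine contr_mem_formsPart (hω k) (ih ?_)
    rw [List.length_cons] at ha
    rwa [add_assoc, add_comm 1]

end Lists

/-! ### Joint injectivity of the iterated contractions -/

section Injective

variable {r : ℕ} (b : Module.Basis (Fin r) F M)

/-- A form killed by all contractions is a polynomial: it is fixed by each of the substitutions
eliminating one vector of the dual basis, and together these eliminate all one-forms. -/
theorem eq_extAug_smul_one {w : Forms F V M}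
    (h : ∀ i, contr ((1 : Poly F V) ⊗ₜ[F] b i) w = 0) : w = extAug F V M w • 1 := by
  let P : Fin r → Module.Dual F M →ₗ[F] Module.Dual F M := fun i =>
    LinearMap.id - (Module.Dual.eval F M (b i)).smulRight (b.coord i)
  let Q : (Module.Dual F M →ₗ[F] Module.Dual F M) → Forms F V M →ₐ[Poly F V] Forms F V M :=
    fun f => Algebra.TensorProduct.map (AlgHom.id _ _) (ExteriorAlgebra.map f)
  have hQ : ∀ i, Q (P i) w = w := by
    intro i
    have key : ∀ a : Forms F V M, a = Q (P i) a +
        ((1 : Poly F V) ⊗ₜ[F] ExteriorAlgebra.ι F (b.coord i)) * contr (1 ⊗ₜ[F] b i) a := by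
      intro a
      induction a using TensorProduct.induction_on with
      | zero => simp
      | add x y hx hy =>
        simp only [map_add, mul_add]
        nth_rewrite 1 [hx, hy]
        abel
      | tmul p x =>
        have hx := eq_map_add_ι_mul_contractLeft (Module.Dual.eval F M (b i)) (b.coord i) x
        simp only [Q, contr_tmul, Algebra.TensorProduct.map_tmul, AlgHom.id_apply,
          Algebra.TensorProduct.tmul_mul_tmul, one_mul]
        rw [← TensorProduct.tmul_add, ← hx]
    have := key w
    rw [h i, mul_zero, add_zero] at this
    exact this.symm
  have hQl : ∀ l : List (Fin r), Q ((l.map P).prod) w = w := by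
    intro l
    induction l with
    | nil =>
      change Q LinearMap.id w = w
      simp [Q, ExteriorAlgebra.map_id]
    | cons i l ih =>
      have : Q (((i :: l).map P).prod) = (Q (P i)).comp (Q ((l.map P).prod)) := by
        simp only [Q, List.map_cons, List.prod_cons]
        rw [← Algebra.TensorProduct.map_comp, ExteriorAlgebra.map_comp_map]
        rfl
      rw [this, AlgHom.comp_apply, ih, hQ]
  have hP : ∀ (l : List (Fin r)) j,
      (l.map P).prod (b.coord j) = if j ∈ l then 0 else b.coord j := by
    intro l j
    induction l with
    | nil => simp
    | cons i l ih =>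
      rw [List.map_cons, List.prod_cons, Module.End.mul_apply, ih]
      by_cases hj : j ∈ l
      · simp [hj]
      · by_cases hij : i = j
        · subst hij; simp [hj, P]
        · simp [hj, P, Ne.symm hij]
  have hz : ((List.finRange r).map P).prod = 0 := by
    refine b.dualBasis.ext fun j => ?_
    rw [Module.Basis.coe_dualBasis, hP]
    simp
  have hw := hQl (List.finRange r)
  rw [hz] at hw
  have hfin : ∀ a : Forms F V M, Q 0 a = extAug F V M a • 1 := by
    intro a
    induction a using TensorProduct.induction_on with
    | zero => simp
    | add x y hx hy => simp only [map_add, add_smul, hx, hy]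
    | tmul p x =>
      simp only [Q, Algebra.TensorProduct.map_tmul, AlgHom.id_apply, map_zero_apply, extAug_tmul]
      rw [Algebra.TensorProduct.one_def, TensorProduct.smul_tmul', smul_eq_mul, mul_one,
        Algebra.algebraMap_eq_smul_one, TensorProduct.tmul_smul, TensorProduct.smul_tmul']
  rw [← hfin, hw]

/-- By Cramer's rule, a form killed by the contractions by a family with nonzero Jacobian is killed
by all contractions. -/
theorem contr_eq_zero_of_jacobian_ne_zero {ω : Fin r → Poly F V ⊗[F] M} (hJ : jacobian b ω ≠ 0)
    {w : Forms F V M} (h : ∀ i, contr (ω i) w = 0) (j : Fin r) :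
    contr ((1 : Poly F V) ⊗ₜ[F] b j) w = 0 := by
  set B := Algebra.TensorProduct.basis (Poly F V) b with hB
  set A : Matrix (Fin r) (Fin r) (Poly F V) := Matrix.of fun i j => B.repr (ω i) j with hA
  have hω : ∀ i, ω i = ∑ k, A i k • ((1 : Poly F V) ⊗ₜ[F] b k) := by
    intro i
    conv_lhs => rw [← B.sum_repr (ω i)]
    simp [hA, hB]
  have hcr : jacobian b ω • ((1 : Poly F V) ⊗ₜ[F] b j) = ∑ i, A.adjugate j i • ω i := by
    have hadj := Matrix.adjugate_mul A
    simp_rw [hω, Finset.smul_sum, smul_smul]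
    rw [Finset.sum_comm]
    simp_rw [← Finset.sum_smul, ← Matrix.mul_apply, hadj, Matrix.smul_apply, Matrix.one_apply,
      smul_eq_mul, mul_ite, mul_one, mul_zero, ite_smul, zero_smul]
    simp [jacobian, hA, hB]
  have h0 : jacobian b ω • contr ((1 : Poly F V) ⊗ₜ[F] b j) w = 0 := by
    rw [← LinearMap.smul_apply, ← map_smul, hcr, map_sum, LinearMap.sum_apply]
    refine Finset.sum_eq_zero fun i _ => ?_
    rw [map_smul, LinearMap.smul_apply, h, smul_zero]
  exact (smul_eq_zero.1 h0).resolve_left hJ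

theorem eq_zero_of_forall_list {ω : Fin r → Poly F V ⊗[F] M} (hJ : jacobian b ω ≠ 0)
    {w : Forms F V M} (h : ∀ l : List (Fin r), extAug F V M (contrList ω l w) = 0) : w = 0 := by
  have key : ∀ k, ∀ l : List (Fin r), r + 1 ≤ l.length + k → contrList ω l w = 0 := by
    intro k
    induction k with
    | zero =>
      intro l hl
      rw [contrList_eq_zero]
      intro hn
      have := hn.length_le_card
      simp at this
      omega
    | succ k ih =>
      intro l hl
      have h1 : ∀ i, contr (ω i) (contrList ω l w) = 0 := by
        intro i
        rw [← contrList_cons]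
        exact ih _ (by simp; omega)
      rw [eq_extAug_smul_one b (contr_eq_zero_of_jacobian_ne_zero b hJ h1), h, zero_smul]
  simpa using key (r + 1) [] (by simp)

/-- The coordinates of a form with respect to the frame dual to `ω`. -/
def coordForm (ω : Fin r → Poly F V ⊗[F] M) (I : Finset (Fin r)) :
    Forms F V M →ₗ[Poly F V] Poly F V :=
  (extAug F V M).toLinearMap ∘ₗ contrList ω I.toList

theorem coordForm_apply (ω : Fin r → Poly F V ⊗[F] M) (I : Finset (Fin r)) (w : Forms F V M) :
    coordForm ω I w = extAug F V M (contrList ω I.toList w) := rfl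

theorem eq_zero_of_coordForm {ω : Fin r → Poly F V ⊗[F] M} (hJ : jacobian b ω ≠ 0)
    {w : Forms F V M} (h : ∀ I, coordForm ω I w = 0) : w = 0 := by
  refine eq_zero_of_forall_list b hJ fun l => ?_
  by_cases hl : l.Nodup
  · have hp : l.Perm l.toFinset.toList := by
      rw [List.perm_ext_iff_of_nodup hl (Finset.nodup_toList _)]
      simp
    have h0 := h l.toFinset
    rw [coordForm_apply] at h0
    rcases contrList_perm ω hp with h | h <;> simp [h, h0]
  · simp [contrList_eq_zero ω hl]

end Injective

/-! ### The volume form and the dual frame -/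

section Frame

variable {r : ℕ} (b : Module.Basis (Fin r) F M)

/-- The product of the dual basis vectors, in the order of the list. -/
def dualProd (l : List (Fin r)) : Forms F V M :=
  1 ⊗ₜ (l.map fun i => ExteriorAlgebra.ι F (b.coord i)).prod

theorem dualProd_mem (l : List (Fin r)) :
    (dualProd b l : Forms F V M) ∈ formsPart F V M 0 l.length := by
  refine tmul_mem_formsPart (by rw [polyPart, pow_zero]; exact Submodule.one_le.1 le_rfl) ?_
  induction l with
  | nil => rw [ExteriorAlgebra.exteriorPower]; simp
  | cons i l ih =>
    rw [ExteriorAlgebra.exteriorPower, List.length_cons, pow_succ', List.map_cons, List.prod_cons]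
    exact Submodule.mul_mem_mul (LinearMap.mem_range_self _ _) ih

theorem contractLeft_dualProd_of_notMem {l : List (Fin r)} {i : Fin r} (hi : i ∉ l) :
    CliffordAlgebra.contractLeft (Module.Dual.eval F M (b i))
      (l.map fun i => ExteriorAlgebra.ι F (b.coord i)).prod = 0 := by
  induction l with
  | nil => exact CliffordAlgebra.contractLeft_one _ _
  | cons j l ih =>
    rw [List.mem_cons, not_or] at hi
    rw [List.map_cons, List.prod_cons, CliffordAlgebra.contractLeft_ι_mul, ih hi.2]
    simp [hi.1]

theorem contrList_reverse_dualProd {l : List (Fin r)} (hl : l.Nodup) :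
    contrList (fun i => (1 : Poly F V) ⊗ₜ[F] b i) l.reverse (dualProd b l) = 1 := by
  induction l with
  | nil => rfl
  | cons i l ih =>
    rw [List.nodup_cons] at hl
    have : contrList (fun i => (1 : Poly F V) ⊗ₜ[F] b i) [i] (dualProd b (i :: l)) =
        dualProd b l := by
      rw [contrList_cons, contrList_nil, dualProd, contr_tmul, List.map_cons, List.prod_cons,
        CliffordAlgebra.contractLeft_ι_mul, contractLeft_dualProd_of_notMem b hl.1]
      simp [dualProd]
    rw [List.reverse_cons, contrList_append, this, ih hl.2]

/-- The volume form of `M*` determined by the basis `b`. The factors are in reverse order, so that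
contracting by the basis vectors in the order of `List.finRange r` gives `1` without a sign. -/
def volForm : Forms F V M := dualProd b (List.finRange r).reverse

theorem volForm_mem : (volForm b : Forms F V M) ∈ formsPart F V M 0 r := by
  simpa [volForm] using dualProd_mem (V := V) b (List.finRange r).reverse

/-- Contracting the volume form by all the `ω i` gives the Jacobian, as both sides are alternating
in `ω`. -/
theorem extAug_contrList_volForm (ω : Fin r → Poly F V ⊗[F] M) :
    extAug F V M (contrList ω (List.finRange r) (volForm b)) = jacobian b ω := by
  let T : (Poly F V ⊗[F] M) [⋀^Fin r]→ₗ[Poly F V] Poly F V :=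
    ((extAug F V M).toLinearMap ∘ₗ LinearMap.applyₗ (volForm b) ∘ₗ
      (ExteriorAlgebra.lift (Poly F V) ⟨contr, fun θ => LinearMap.ext fun a =>
        contr_contr_self θ a⟩).toLinearMap).compAlternatingMap
          (ExteriorAlgebra.ιMulti (Poly F V) r)
  have hT : ∀ v, T v = extAug F V M (contrList v (List.finRange r) (volForm b)) := by
    intro v
    simp [T, ExteriorAlgebra.ιMulti_apply, map_list_prod, contrList, List.ofFn_eq_map,
      Function.comp_def]
  have h1 : T (Algebra.TensorProduct.basis (Poly F V) b) = 1 := by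
    have := contrList_reverse_dualProd (V := V) b
      (l := (List.finRange r).reverse) (List.nodup_reverse.2 (List.nodup_finRange r))
    rw [List.reverse_reverse] at this
    rw [hT, show ⇑(Algebra.TensorProduct.basis (Poly F V) b) = fun i => 1 ⊗ₜ[F] b i from
      funext fun i => by simp, volForm, this, map_one]
  rw [← hT, T.eq_smul_basis_det (Algebra.TensorProduct.basis (Poly F V) b), h1, one_smul,
    Module.Basis.det_apply, ← Matrix.det_transpose]
  rfl

/-- A frame `β` of forms dual to the iterated contractions by `ω`, up to the common factor `Δ`. It
consists of the quotients by `J` of `Δ` times the contractions of the volume form; `β I` has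
exterior degree `|I|` and polynomial degree `d - ∑_{i ∈ I} e i`. -/
theorem exists_frame {ω : Fin r → Poly F V ⊗[F] M} {e : Fin r → ℕ}
    (hω : ∀ i, ω i ∈ derPart F V M (e i)) {Δ : Poly F V} {d : ℕ} (hΔ0 : Δ ≠ 0)
    (hΔ : Δ ∈ polyPart F V d) (hdvd : jacobian b ω ∣ Δ) :
    ∃ β : Finset (Fin r) → Forms F V M,
      (∀ I, ∃ k, k + ∑ i ∈ I, e i = d ∧ β I ∈ formsPart F V M k I.card) ∧
      ∀ I K, coordForm ω K (β I) = if K = I then Δ else 0 := by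
  obtain ⟨p, hp⟩ := hdvd
  have hJdeg : jacobian b ω ∈ polyPart F V (∑ i, e i) := by
    rw [← extAug_contrList_volForm]
    have := contrList_mem_formsPart ω hω (List.finRange r) (i := 0) (j := 0)
      (a := volForm b) (by simpa using volForm_mem b)
    have h := extAug_mem_polyPart this
    rwa [add_zero, ← List.ofFn_eq_map, List.sum_ofFn] at h
  obtain ⟨k, hk, hpk⟩ := exists_mem_polyPart_of_mul_eq hΔ0 hΔ hJdeg hp
  let β₀ : Finset (Fin r) → Forms F V M := fun I => p • contrList ω Iᶜ.toList (volForm b)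
  have hdeg : ∀ I, ∃ k, k + ∑ i ∈ I, e i = d ∧ β₀ I ∈ formsPart F V M k I.card := by
    intro I
    refine ⟨k + ∑ i ∈ Iᶜ, e i, ?_, ?_⟩
    · rw [add_assoc, Finset.sum_compl_add_sum, hk]
    · refine smul_mem_formsPart hpk ?_
      have hc : I.card + Iᶜ.toList.length = r := by
        rw [Finset.length_toList, Finset.card_add_card_compl, Fintype.card_fin]
      have := contrList_mem_formsPart ω hω Iᶜ.toList (i := 0) (j := I.card)
        (a := volForm b) (by rw [hc]; exact volForm_mem b)
      rwa [add_zero, Finset.sum_map_toList] at this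
  have hval : ∀ I l, extAug F V M (contrList ω l (β₀ I)) =
      p * extAug F V M (contrList ω (l ++ Iᶜ.toList) (volForm b)) := by
    intro I l
    rw [map_smul, map_smul, smul_eq_mul, contrList_append]
  have hsame : ∀ I l, l.Perm I.toList → extAug F V M (contrList ω l (β₀ I)) = Δ ∨
        extAug F V M (contrList ω l (β₀ I)) = - Δ := by
    intro I l hl
    have hperm : (l ++ Iᶜ.toList).Perm (List.finRange r) := by
      refine (hl.append_right _).trans ?_
      rw [List.perm_ext_iff_of_nodup _ (List.nodup_finRange r)]
      · intro a; simp [em]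
      · refine List.Nodup.append (Finset.nodup_toList _) (Finset.nodup_toList _) ?_
        intro a; simp
    rw [hval]
    rcases contrList_perm ω hperm with h | h
    · left; rw [h, extAug_contrList_volForm, hp, mul_comm]
    · right
      rw [h, map_neg, extAug_contrList_volForm, hp, mul_neg, mul_comm]
  have hdiff : ∀ I K, K ≠ I → coordForm ω K (β₀ I) = 0 := by
    intro I K hne
    rw [coordForm_apply, hval]
    by_cases hn : (K.toList ++ Iᶜ.toList).Nodup
    · have hsub : K ⊆ I := by
        intro a ha
        by_contra hI
        exact (List.disjoint_of_nodup_append hn) (a := a) (by simpa using ha) (by simpa using hI)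
      have hlt := Finset.card_lt_card (hsub.ssubset_of_ne hne)
      obtain ⟨j, hj⟩ := Nat.exists_eq_add_of_lt hlt
      have hc := Finset.card_add_card_compl I
      rw [Fintype.card_fin] at hc
      have := contrList_mem_formsPart ω hω (K.toList ++ Iᶜ.toList) (i := 0) (j := j + 1)
        (a := volForm b) (by
          rw [List.length_append, Finset.length_toList, Finset.length_toList,
            show j + 1 + (K.card + Iᶜ.card) = r by omega]
          exact volForm_mem b)
      rw [extAug_eq_zero this, mul_zero]
    · rw [contrList_eq_zero ω hn, map_zero, mul_zero]
  classical
  -- normalise the sign of the nonzero coordinate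
  let β : Finset (Fin r) → Forms F V M := fun I =>
    if coordForm ω I (β₀ I) = Δ then β₀ I else - β₀ I
  have hβ : ∀ I, β I = β₀ I ∨ β I = - β₀ I := fun I => by
    by_cases h : coordForm ω I (β₀ I) = Δ <;> simp [β, h]
  refine ⟨β, fun I => ?_, fun I K => ?_⟩
  · obtain ⟨k, hk, hm⟩ := hdeg I
    refine ⟨k, hk, ?_⟩
    rcases hβ I with h | h <;> rw [h]
    · exact hm
    · exact neg_mem hm
  · split_ifs with hKI
    · subst hKI
      by_cases h : coordForm ω K (β₀ K) = Δ
      · simp only [β, if_pos h, h]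
      · have := (hsame K K.toList (List.Perm.refl _)).resolve_left h
        simp only [β, if_neg h, map_neg]
        rw [coordForm_apply, this, neg_neg]
    · rcases hβ I with h | h <;> simp [h, hdiff I K hKI]

end Frame

/-! ### Semi-invariant forms -/

section Semi

variable (ρ : Representation F G V) (σ : Representation F G M) (χ : G →* Fˣ)

/-- `w` is a `χ`-semi-invariant element of `S(V*) ⊗ ⋀ M*`. -/
def IsSemiForm (w : Forms F V M) : Prop :=
  ∀ g, formsAct ρ σ g w = (χ g : F) • w

/-- `f` is a bihomogeneous invariant of positive degree, that is, one of the generators of the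
coinvariant ideal. -/
def IsGenerator (f : Forms F V M) : Prop :=
  (∃ i j, 0 < i + j ∧ f ∈ formsPart F V M i j) ∧ ∀ g, formsAct ρ σ g f = f

theorem mem_polyInvariants {p : Poly F V} :
    p ∈ polyInvariants ρ ↔ ∀ g, polyAct ρ g p = p := by
  simp [polyInvariants, Algebra.mem_iInf, AlgHom.mem_equalizer]

variable {ρ σ χ}

theorem IsGenerator.mem {f : Forms F V M} (hf : IsGenerator ρ σ f) :
    f ∈ coinvariantSubspace ρ σ :=
  (mem_coinvariantSubspace _ _ _).2 (TwoSidedIdeal.subset_span hf)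

theorem mul_mem_coinvariantSubspace {f : Forms F V M} (hf : f ∈ coinvariantSubspace ρ σ)
    (a : Forms F V M) : f * a ∈ coinvariantSubspace ρ σ := by
  rw [mem_coinvariantSubspace] at hf ⊢
  exact TwoSidedIdeal.mul_mem_right _ _ _ hf

theorem smul_mem_coinvariantSubspace (p : Poly F V) {f : Forms F V M}
    (hf : f ∈ coinvariantSubspace ρ σ) : p • f ∈ coinvariantSubspace ρ σ := by
  rw [mem_coinvariantSubspace] at hf ⊢
  rw [← one_mul f, ← smul_mul_assoc]
  exact TwoSidedIdeal.mul_mem_left _ _ _ hf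

theorem IsSemiForm.contr {θ : Poly F V ⊗[F] M} (hθ : IsInvariantTensor ρ σ θ)
    {w : Forms F V M} (hw : IsSemiForm ρ σ χ w) : IsSemiForm ρ σ χ (contr θ w) := by
  intro g
  rw [formsAct_contr, hθ g, hw g, LinearMap.map_smul_of_tower]

theorem IsSemiForm.contrList {ι : Type*} {ω : ι → Poly F V ⊗[F] M}
    (hω : ∀ i, IsInvariantTensor ρ σ (ω i)) {w : Forms F V M} (hw : IsSemiForm ρ σ χ w)
    (l : List ι) : IsSemiForm ρ σ χ (contrList ω l w) := by
  induction l with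
  | nil => simpa using hw
  | cons i l ih => rw [contrList_cons]; exact ih.contr (hω i)

theorem IsSemiForm.gradeInv {w : Forms F V M} (hw : IsSemiForm ρ σ χ w) :
    IsSemiForm ρ σ χ (gradeInv F V M w) := by
  intro g
  rw [formsAct_gradeInv, hw g]
  exact LinearMap.map_smul_of_tower (SuperCoinvariant.gradeInv F V M).toLinearMap _ _

theorem IsSemiForm.polyAct_extAug {w : Forms F V M} (hw : IsSemiForm ρ σ χ w) (g : G) :
    polyAct ρ g (extAug F V M w) = (χ g : F) • extAug F V M w := by
  rw [← extAug_formsAct ρ σ, hw g]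
  exact LinearMap.map_smul_of_tower (extAug F V M).toLinearMap _ _

theorem IsSemiForm.exists_extAug {Δ : Poly F V} {d : ℕ} (hΔ : IsVandermondian ρ χ Δ d)
    {w : Forms F V M} (hw : IsSemiForm ρ σ χ w) :
    ∃ h ∈ polyInvariants ρ, extAug F V M w = h * Δ :=
  (hΔ.semiInvariants _).1 hw.polyAct_extAug

theorem IsGenerator.contr {θ : Poly F V ⊗[F] M} (hθ : IsInvariantTensor ρ σ θ) {e : ℕ}
    (he : 0 < e) (hdeg : θ ∈ derPart F V M e) {f : Forms F V M} (hf : IsGenerator ρ σ f) :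
    IsGenerator ρ σ (contr θ f) := by
  obtain ⟨⟨i, j, hij, hm⟩, hinv⟩ := hf
  refine ⟨?_, fun g => by rw [formsAct_contr, hθ g, hinv g]⟩
  cases j with
  | zero =>
    rw [contr_eq_zero_of_mem_formsPart_zero θ hm]
    exact ⟨1, 0, by omega, zero_mem _⟩
  | succ j => exact ⟨e + i, j, by omega, contr_mem_formsPart hdeg hm⟩

theorem IsGenerator.extAug {f : Forms F V M} (hf : IsGenerator ρ σ f) :
    extAug F V M f ∈ polyInvariants ρ ∧ SymmetricAlgebra.algebraMapInv (extAug F V M f) = 0 := by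
  obtain ⟨⟨i, j, hij, hm⟩, hinv⟩ := hf
  refine ⟨(mem_polyInvariants ρ).2 fun g => by rw [← extAug_formsAct ρ σ, hinv g], ?_⟩
  cases j with
  | zero => exact algebraMapInv_eq_zero_of_mem_polyPart (by omega) (extAug_mem_polyPart hm)
  | succ j => rw [extAug_eq_zero hm, map_zero]

/-- The coordinates of a product of a semi-invariant form with a generator of the coinvariant ideal
are multiples of `Δ` by invariants without constant term. Contractions of degree zero have to be
avoided here. -/
theorem exists_extAug_contrList_mul {ι : Type*} {ω : ι → Poly F V ⊗[F] M} {e : ι → ℕ}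
    {Z : Set ι} (hω : ∀ i, IsInvariantTensor ρ σ (ω i)) (hdeg : ∀ i, ω i ∈ derPart F V M (e i))
    (he : ∀ i ∉ Z, 0 < e i) {Δ : Poly F V} {d : ℕ} (hΔ : IsVandermondian ρ χ Δ d) (l : List ι)
    (hl : ∀ i ∈ l, i ∉ Z) {w f : Forms F V M} (hw : IsSemiForm ρ σ χ w)
    (hf : IsGenerator ρ σ f) :
    ∃ h, SymmetricAlgebra.algebraMapInv h = 0 ∧ extAug F V M (contrList ω l (w * f)) = h * Δ := by
  induction l using List.reverseRecOn generalizing w f with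
  | nil =>
    obtain ⟨h, -, hh⟩ := hw.exists_extAug hΔ
    refine ⟨h * extAug F V M f, by rw [map_mul, hf.extAug.2, mul_zero], ?_⟩
    rw [contrList_nil, map_mul, hh]
    ring
  | append_singleton l k ih =>
    have hl' : ∀ i ∈ l, i ∉ Z := fun i hi => hl i (by simp [hi])
    obtain ⟨h₁, h₁0, hh₁⟩ := ih hl' (hw.contr (hω k)) hf
    obtain ⟨h₂, h₂0, hh₂⟩ := ih hl' hw.gradeInv
      (hf.contr (hω k) (he k (hl k (by simp))) (hdeg k))
    refine ⟨h₁ + h₂, by rw [map_add, h₁0, h₂0, add_zero], ?_⟩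
    rw [contrList_append, contrList_cons, contrList_nil, contr_mul, map_add, map_add, hh₁, hh₂,
      add_mul]

end Semi

/-! ### Projection onto the semi-invariants -/

section Projection

variable (ρ : Representation F G V) (σ : Representation F G M) (χ : G →* Fˣ) [Fintype G]

/-- The projection of `S(V*) ⊗ ⋀ M*` onto its `χ`-semi-invariants. -/
def semiProj : Forms F V M →ₗ[F] Forms F V M :=
  (Fintype.card G : F)⁻¹ • ∑ g : G, ((χ g)⁻¹ : Fˣ).val • (formsAct ρ σ g).toLinearMap

theorem semiProj_apply (w : Forms F V M) : semiProj ρ σ χ w =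
    (Fintype.card G : F)⁻¹ • ∑ g : G, ((χ g)⁻¹ : Fˣ).val • formsAct ρ σ g w := by
  simp [semiProj]

theorem isSemiForm_semiProj (w : Forms F V M) : IsSemiForm ρ σ χ (semiProj ρ σ χ w) := by
  intro g
  rw [semiProj_apply, map_smul, smul_comm]
  congr 1
  rw [map_sum, Finset.smul_sum]
  refine Fintype.sum_equiv (Equiv.mulLeft g) _ _ fun h => ?_
  rw [map_smul, Equiv.coe_mulLeft, formsAct_mul_apply, smul_smul, map_mul, ← Units.val_mul]
  congr 2
  rw [mul_inv, mul_inv_cancel_left]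

theorem semiProj_mul {f : Forms F V M} (hf : ∀ g, formsAct ρ σ g f = f) (a : Forms F V M) :
    semiProj ρ σ χ (a * f) = semiProj ρ σ χ a * f := by
  simp only [semiProj_apply, map_mul, hf, smul_mul_assoc, Finset.sum_mul]

theorem semiProj_mem_formsPart {i j : ℕ} {w : Forms F V M} (hw : w ∈ formsPart F V M i j) :
    semiProj ρ σ χ w ∈ formsPart F V M i j := by
  rw [semiProj_apply]
  exact Submodule.smul_mem _ _ (Submodule.sum_mem _ fun g _ =>
    Submodule.smul_mem _ _ (formsAct_mem_formsPart ρ σ g hw))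

variable [CharZero F]

variable {ρ σ χ} in
theorem IsSemiForm.semiProj_eq {w : Forms F V M} (hw : IsSemiForm ρ σ χ w) :
    semiProj ρ σ χ w = w := by
  have hc : (Fintype.card G : F) ≠ 0 := Nat.cast_ne_zero.2 Fintype.card_ne_zero
  rw [semiProj_apply]
  simp_rw [hw _, smul_smul, Units.inv_mul, one_smul]
  rw [Finset.sum_const, Finset.card_univ, ← Nat.cast_smul_eq_nsmul F, smul_smul, inv_mul_cancel₀ hc,
    one_smul]

theorem semiProj_sub_mem {w : Forms F V M}
    (hw : ∀ g, formsAct ρ σ g w - (χ g : F) • w ∈ coinvariantSubspace ρ σ) :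
    semiProj ρ σ χ w - w ∈ coinvariantSubspace ρ σ := by
  have hc : (Fintype.card G : F) ≠ 0 := Nat.cast_ne_zero.2 Fintype.card_ne_zero
  have : semiProj ρ σ χ w - w = (Fintype.card G : F)⁻¹ • ∑ g : G, ((χ g)⁻¹ : Fˣ).val •
      (formsAct ρ σ g w - (χ g : F) • w) := by
    simp_rw [smul_sub, smul_smul, Units.inv_mul, one_smul]
    rw [Finset.sum_sub_distrib, smul_sub, ← semiProj_apply, Finset.sum_const, Finset.card_univ,
      ← Nat.cast_smul_eq_nsmul F, smul_smul, inv_mul_cancel₀ hc, one_smul]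
  rw [this]
  exact Submodule.smul_mem _ _ (Submodule.sum_mem _ fun g _ => Submodule.smul_mem _ _ (hw g))

/-- Semi-invariant elements of the coinvariant ideal have coordinates in the multiples of `Δ` by
invariants without constant term. By supercommutation every element of the ideal is a sum of left
multiples `a * f` of generators, and the projection replaces `a` by a semi-invariant form. -/
theorem exists_extAug_contrList_of_mem {ι : Type*} {ω : ι → Poly F V ⊗[F] M} {e : ι → ℕ}
    {Z : Set ι} (hω : ∀ i, IsInvariantTensor ρ σ (ω i)) (hdeg : ∀ i, ω i ∈ derPart F V M (e i))
    (he : ∀ i ∉ Z, 0 < e i) {Δ : Poly F V} {d : ℕ} (hΔ : IsVandermondian ρ χ Δ d) (l : List ι)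
    (hl : ∀ i ∈ l, i ∉ Z) {w : Forms F V M} (hw : IsSemiForm ρ σ χ w)
    (hJ : w ∈ coinvariantSubspace ρ σ) :
    ∃ h, SymmetricAlgebra.algebraMapInv h = 0 ∧ extAug F V M (contrList ω l w) = h * Δ := by
  rw [← hw.semiProj_eq]
  clear hw
  rw [mem_coinvariantSubspace, coinvariantIdeal,
    TwoSidedIdeal.mem_span_iff_mem_addSubgroup_closure] at hJ
  induction hJ using AddSubgroup.closure_induction with
  | mem x hx =>
    obtain ⟨_, ⟨a, -, f, hf, rfl⟩, c, -, rfl⟩ := hx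
    have hf' : IsGenerator ρ σ f := hf
    obtain ⟨⟨i, j, hij, hm⟩, hinv⟩ := hf
    change ∃ h, _ ∧ extAug F V M (contrList ω l (semiProj ρ σ χ (a * f * c))) = _
    rw [mul_assoc, mul_eq_iterate_gradeInv_mul hm, ← mul_assoc, semiProj_mul ρ σ χ hinv]
    exact exists_extAug_contrList_mul hω hdeg he hΔ l hl (isSemiForm_semiProj ρ σ χ _) hf'
  | zero => exact ⟨0, map_zero _, by simp⟩
  | add x y _ _ hx hy =>
    obtain ⟨h₁, h₁0, hh₁⟩ := hx
    obtain ⟨h₂, h₂0, hh₂⟩ := hy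
    exact ⟨h₁ + h₂, by rw [map_add, h₁0, h₂0, add_zero],
      by rw [map_add, map_add, map_add, hh₁, hh₂, add_mul]⟩
  | neg x _ hx =>
    obtain ⟨h, h0, hh⟩ := hx
    exact ⟨-h, by rw [map_neg, h0, neg_zero], by rw [map_neg, map_neg, map_neg, hh, neg_mul]⟩

end Projection

/-! ### A basis of the semi-invariant coinvariants -/

section Basis

variable {ρ : Representation F G V} {σ : Representation F G M} {χ : G →* Fˣ}
  {r : ℕ} (b : Module.Basis (Fin r) F M) {ω : Fin r → Poly F V ⊗[F] M} {e : Fin r → ℕ}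
  {Δ : Poly F V} {d : ℕ} {β : Finset (Fin r) → Forms F V M}

theorem isSemiForm_frame (hω : ∀ i, IsInvariantTensor ρ σ (ω i)) (hJ : jacobian b ω ≠ 0)
    (hΔ : IsVandermondian ρ χ Δ d) (hβ : ∀ I K, coordForm ω K (β I) = if K = I then Δ else 0)
    (I : Finset (Fin r)) : IsSemiForm ρ σ χ (β I) := by
  intro g
  rw [← sub_eq_zero]
  refine eq_zero_of_coordForm b hJ fun K => ?_
  have hg : ∀ l w, formsAct ρ σ g (contrList ω l w) = contrList ω l (formsAct ρ σ g w) := by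
    intro l w
    induction l with
    | nil => simp
    | cons i l ih => rw [contrList_cons, formsAct_contr, hω i g, ih, contrList_cons]
  have h1 : coordForm ω K (formsAct ρ σ g (β I)) = polyAct ρ g (coordForm ω K (β I)) := by
    rw [coordForm_apply, ← hg, extAug_formsAct, ← coordForm_apply]
  have h2 : polyAct ρ g Δ = (χ g : F) • Δ :=
    (hΔ.semiInvariants Δ).2 ⟨1, one_mem _, (one_mul Δ).symm⟩ g
  rw [map_sub, h1, LinearMap.map_smul_of_tower, hβ]
  split_ifs
  · rw [h2, sub_self]
  · simp

/-- A frame element involving an index `k` for which the coinvariant ideal contains a one-form `θ`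
dual to `ω k` lies in the coinvariant ideal, being equal to `θ` times its contraction by `ω k`. -/
theorem frame_mem_coinvariantSubspace (hJ : jacobian b ω ≠ 0)
    (hβ : ∀ I K, coordForm ω K (β I) = if K = I then Δ else 0) {k : Fin r} {θ : Forms F V M}
    (hθ : IsGenerator ρ σ θ) (hθ1 : θ ∈ formsPart F V M 0 1)
    (hθω : ∀ l, contr (ω l) θ = if l = k then 1 else 0) {I : Finset (Fin r)} (hk : k ∈ I) :
    β I ∈ coinvariantSubspace ρ σ := by
  suffices h : θ * contr (ω k) (β I) = β I by
    rw [← h]; exact mul_mem_coinvariantSubspace hθ.mem _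
  have hinv : gradeInv F V M θ = (-1 : Poly F V) • θ := by
    suffices h : formsPart F V M 0 1 ≤ LinearMap.ker
        ((gradeInv F V M).toLinearMap.restrictScalars F + LinearMap.id) by
      exact (eq_neg_of_add_eq_zero_left (h hθ1)).trans (neg_one_smul (Poly F V) θ).symm
    refine formsPart_le fun p hp w hw => ?_
    rw [ExteriorAlgebra.exteriorPower, pow_one] at hw
    obtain ⟨m, rfl⟩ := hw
    have := CliffordAlgebra.involute_ι (Q := (0 : QuadraticForm F (Module.Dual F M))) m
    simp [this, TensorProduct.tmul_neg]
  have hθ0 : extAug F V M θ = 0 := extAug_eq_zero hθ1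
  have hlist : ∀ l : List (Fin r), k ∉ l → ∀ u : Forms F V M,
      extAug F V M (contrList ω l (θ * u)) = 0 := by
    intro l
    induction l using List.reverseRecOn with
    | nil => intro _ u; simp [hθ0]
    | append_singleton l i ih =>
      intro hkl u
      rw [List.mem_append, List.mem_singleton, not_or] at hkl
      rw [contrList_append, contrList_cons, contrList_nil, contr_mul, hθω, if_neg (Ne.symm hkl.2),
        zero_mul, zero_add, hinv, smul_mul_assoc, map_smul, map_smul, ih hkl.1, smul_zero]
  rw [← sub_eq_zero]
  refine eq_zero_of_coordForm b hJ fun K => ?_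
  rw [map_sub, sub_eq_zero]
  -- contracting by `ω k` first turns both sides into `contr (ω k) (β I)`; without that contraction
  -- the factor `θ` survives, and both coordinates vanish
  by_cases hkK : k ∈ K
  · have hp : K.toList.Perm ((K.erase k).toList ++ [k]) := by
      refine List.Perm.trans ?_ (List.perm_append_singleton k _).symm
      conv_lhs => rw [← Finset.insert_erase hkK]
      exact Finset.toList_insert (Finset.notMem_erase k K)
    have hlast : contrList ω ((K.erase k).toList ++ [k]) (θ * contr (ω k) (β I)) =
        contrList ω ((K.erase k).toList ++ [k]) (β I) := by
      simp only [contrList_append, contrList_cons, contrList_nil]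
      rw [contr_mul, hθω, if_pos rfl, one_mul, contr_contr_self, mul_zero, add_zero]
    rw [coordForm_apply, coordForm_apply]
    rcases contrList_perm ω hp with h | h <;> rw [h, h, hlast]
  · rw [hβ, if_neg (by rintro rfl; exact hkK hk), coordForm_apply, hlist _ (by simpa using hkK)]

variable (e d) in
/-- The index set of the basis of the component of bidegree `(i, j)` of the semi-invariant
coinvariants: the `j`-element sets avoiding `Z` for which the frame element has polynomial
degree `i`. -/
def frameIndex (Z : Finset (Fin r)) (i j : ℕ) : Finset (Finset (Fin r)) :=
  Zᶜ.powerset.filter fun I => I.card = j ∧ i + ∑ k ∈ I, e k = d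

/-- Modulo the coinvariant ideal, semi-invariant forms are linear combinations of frame
elements. -/
theorem exists_sub_sum_mem (hω : ∀ i, IsInvariantTensor ρ σ (ω i))
    (hdeg : ∀ i, ω i ∈ derPart F V M (e i)) (hJ : jacobian b ω ≠ 0)
    (hΔ : IsVandermondian ρ χ Δ d) (hβ : ∀ I K, coordForm ω K (β I) = if K = I then Δ else 0)
    {Z : Finset (Fin r)} (hZ : ∀ I, ∀ k ∈ Z, k ∈ I → β I ∈ coinvariantSubspace ρ σ)
    {i j : ℕ} {w : Forms F V M} (hw : IsSemiForm ρ σ χ w) (hm : w ∈ formsPart F V M i j) :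
    ∃ c : Finset (Fin r) → F,
      w - ∑ I ∈ frameIndex e d Z i j, c I • β I ∈ coinvariantSubspace ρ σ := by
  classical
  choose h hinv hh using fun I : Finset (Fin r) => (hw.contrList hω I.toList).exists_extAug hΔ
  have hcoord : ∀ I, coordForm ω I w = h I * Δ := hh
  have hexp : w = ∑ I, h I • β I := by
    rw [← sub_eq_zero]
    refine eq_zero_of_coordForm b hJ fun K => ?_
    rw [map_sub, map_sum, hcoord]
    simp [hβ]
  have hterm : ∀ I, ∃ c : F, h I • β I - c • β I ∈ coinvariantSubspace ρ σ ∧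
      (I ∉ frameIndex e d Z i j → c = 0) := by
    intro I
    by_cases hIZ : ∃ k ∈ Z, k ∈ I
    · obtain ⟨k, hk, hkI⟩ := hIZ
      refine ⟨0, ?_, fun _ => rfl⟩
      rw [zero_smul, sub_zero]
      exact smul_mem_coinvariantSubspace _ (hZ I k hk hkI)
    by_cases h0 : h I = 0
    · exact ⟨0, by simp [h0], fun _ => rfl⟩
    have hne : coordForm ω I w ≠ 0 := by
      rw [hcoord]; exact mul_ne_zero h0 hΔ.ne_zero
    -- more than `j` contractions kill a form of exterior degree `j`
    have hle : I.card ≤ j := by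
      by_contra hlt
      obtain ⟨l₁, l₂, hl, hl₂⟩ : ∃ l₁ l₂, I.toList = l₁ ++ l₂ ∧ l₂.length = j + 1 := by
        refine ⟨I.toList.take (I.card - (j + 1)), I.toList.drop (I.card - (j + 1)),
          (List.take_append_drop _ _).symm, ?_⟩
        rw [List.length_drop, Finset.length_toList]
        omega
      obtain ⟨k, l₃, rfl⟩ := List.exists_cons_of_length_eq_add_one hl₂
      rw [List.length_cons, Nat.succ_inj] at hl₂
      have := contrList_mem_formsPart ω hdeg l₃ (i := i) (j := 0) (a := w) (by rwa [hl₂, zero_add])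
      apply hne
      rw [coordForm_apply, hl, contrList_append, contrList_cons,
        contr_eq_zero_of_mem_formsPart_zero _ this, map_zero, map_zero]
    obtain ⟨s, rfl⟩ := Nat.exists_eq_add_of_le hle
    have hmem := contrList_mem_formsPart ω hdeg I.toList (i := i) (j := s) (a := w)
      (by rwa [Finset.length_toList, add_comm])
    rw [Finset.sum_map_toList] at hmem
    -- after fewer than `j` contractions the exterior degree is still positive
    have hs : s = 0 := by
      cases s with
      | zero => rfl
      | succ s => exact absurd (extAug_eq_zero hmem) hne
    subst hs
    have hmem' := extAug_mem_polyPart hmem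
    obtain ⟨k, hk, hpk⟩ := exists_mem_polyPart_of_mul_eq hne hmem' hΔ.homogeneous
      ((hcoord I).trans (mul_comm _ _))
    -- `h I` is homogeneous: a scalar, or one of the generators of the coinvariant ideal
    rcases Nat.eq_zero_or_pos k with rfl | hk0
    · rw [polyPart, pow_zero, Submodule.mem_one] at hpk
      obtain ⟨c, hc⟩ := hpk
      refine ⟨c, ?_, fun hI => ?_⟩
      · rw [← hc, algebraMap_smul, sub_self]
        exact zero_mem _
      · refine absurd ?_ hI
        simp only [frameIndex, Finset.mem_filter, Finset.mem_powerset, add_zero, true_and]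
        refine ⟨fun k hkI => ?_, (add_comm _ _).trans (hk.symm.trans (zero_add d))⟩
        rw [Finset.mem_compl]
        exact fun hkZ => hIZ ⟨k, hkZ, hkI⟩
    · refine ⟨0, ?_, fun _ => rfl⟩
      rw [zero_smul, sub_zero, ← one_mul (β I), ← smul_mul_assoc]
      refine mul_mem_coinvariantSubspace (IsGenerator.mem ⟨⟨k, 0, by omega, ?_⟩, fun g => ?_⟩) _
      · rw [Algebra.TensorProduct.one_def, TensorProduct.smul_tmul', smul_eq_mul, mul_one]
        exact tmul_mem_formsPart hpk (by
          rw [ExteriorAlgebra.exteriorPower, pow_zero]; exact Submodule.one_le.1 le_rfl)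
      · rw [formsAct_smul, map_one, (mem_polyInvariants ρ).1 (hinv I) g]
  choose c hc hc0 using hterm
  refine ⟨c, ?_⟩
  have hsum : ∑ I ∈ frameIndex e d Z i j, c I • β I = ∑ I, c I • β I :=
    Finset.sum_subset (Finset.subset_univ _) fun I _ hI => by rw [hc0 I hI, zero_smul]
  rw [hsum, hexp, ← Finset.sum_sub_distrib]
  exact Submodule.sum_mem _ fun I _ => hc I

theorem mem_coinvariantsSemi_mkQ {w : Forms F V M} :
    (coinvariantSubspace ρ σ).mkQ w ∈ coinvariantsSemi ρ σ χ ↔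
      ∀ g, formsAct ρ σ g w - (χ g : F) • w ∈ coinvariantSubspace ρ σ := by
  simp only [coinvariantsSemi, Submodule.mem_iInf, LinearMap.mem_ker, LinearMap.sub_apply,
    LinearMap.smul_apply, LinearMap.id_apply]
  refine forall_congr' fun g => ?_
  rw [← Submodule.Quotient.mk_eq_zero]
  rfl

variable [Finite G] [CharZero F]

theorem finrank_semi_inf_part (hω : ∀ i, IsInvariantTensor ρ σ (ω i))
    (hdeg : ∀ i, ω i ∈ derPart F V M (e i)) (hJ : jacobian b ω ≠ 0)
    (hΔ : IsVandermondian ρ χ Δ d)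
    (hβdeg : ∀ I, ∃ k, k + ∑ i ∈ I, e i = d ∧ β I ∈ formsPart F V M k I.card)
    (hβ : ∀ I K, coordForm ω K (β I) = if K = I then Δ else 0)
    {Z : Finset (Fin r)} (he : ∀ i ∉ Z, 0 < e i)
    (hZ : ∀ I, ∀ k ∈ Z, k ∈ I → β I ∈ coinvariantSubspace ρ σ) (i j : ℕ) :
    Module.finrank F (coinvariantsSemi ρ σ χ ⊓ coinvariantsPart ρ σ i j :
      Submodule F (Coinvariants ρ σ)) = (frameIndex e d Z i j).card := by
  classical
  have := Fintype.ofFinite G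
  set π := (coinvariantSubspace ρ σ).mkQ with hπ
  have hsemi := isSemiForm_frame b hω hJ hΔ hβ
  let v : frameIndex e d Z i j → Coinvariants ρ σ := fun I => π (β I)
  have hv : LinearIndependent F v := by
    rw [Fintype.linearIndependent_iff]
    intro c hc K
    have hmem : ∑ I, c I • β I ∈ coinvariantSubspace ρ σ := by
      rw [← Submodule.Quotient.mk_eq_zero, ← Submodule.mkQ_apply, ← hπ, map_sum]
      simpa [v] using hc
    have hs : IsSemiForm ρ σ χ (∑ I, c I • β I) := by
      intro g
      rw [map_sum, Finset.smul_sum]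
      refine Finset.sum_congr rfl fun I _ => ?_
      rw [map_smul, hsemi I g, smul_comm]
    obtain ⟨h, h0, hh⟩ := exists_extAug_contrList_of_mem ρ σ χ hω hdeg (Z := (Z : Set (Fin r)))
      (by simpa using he) hΔ K.1.toList (fun k hk => by
        have hK := (Finset.mem_filter.1 K.2).1
        rw [Finset.mem_powerset] at hK
        simpa using hK (by simpa using hk)) hs hmem
    rw [← coordForm_apply, map_sum] at hh
    have hterm : ∀ I : frameIndex e d Z i j, coordForm ω K.1 (c I • β I) =
        if I = K then algebraMap F _ (c K) * Δ else 0 := by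
      intro I
      rw [LinearMap.map_smul_of_tower, hβ]
      by_cases hIK : I = K
      · subst hIK; simp [Algebra.smul_def]
      · rw [if_neg (fun h => hIK (Subtype.ext h.symm)), if_neg hIK, smul_zero]
    simp_rw [hterm] at hh
    rw [Finset.sum_ite_eq' Finset.univ K, if_pos (Finset.mem_univ _)] at hh
    have := mul_right_cancel₀ hΔ.ne_zero hh
    rw [← this] at h0
    simpa using h0
  have hspan : coinvariantsSemi ρ σ χ ⊓ coinvariantsPart ρ σ i j =
      Submodule.span F (Set.range v) := by
    refine le_antisymm ?_ (Submodule.span_le.2 ?_)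
    · rintro x ⟨hx, w, hw, rfl⟩
      have hx' := mem_coinvariantsSemi_mkQ.1 hx
      obtain ⟨c, hc⟩ := exists_sub_sum_mem b hω hdeg hJ hΔ hβ hZ (isSemiForm_semiProj ρ σ χ w)
        (semiProj_mem_formsPart ρ σ χ hw)
      have h1 := sub_mem hc (semiProj_sub_mem ρ σ χ hx')
      rw [sub_right_comm, sub_sub_cancel, ← Submodule.Quotient.mk_eq_zero,
        ← Submodule.mkQ_apply, map_sub, sub_eq_zero] at h1
      rw [h1, map_sum]
      refine Submodule.sum_mem _ fun I hI => ?_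
      rw [map_smul]
      exact Submodule.smul_mem _ _ (Submodule.subset_span ⟨⟨I, hI⟩, rfl⟩)
    · rintro _ ⟨⟨I, hI⟩, rfl⟩
      refine ⟨mem_coinvariantsSemi_mkQ.2 fun g => ?_, ?_⟩
      · rw [hsemi I g, sub_self]
        exact zero_mem _
      · obtain ⟨k, hk, hm⟩ := hβdeg I
        obtain ⟨-, hI1, hI2⟩ := Finset.mem_filter.1 hI
        obtain rfl : k = i := by omega
        subst hI1
        exact Submodule.mem_map_of_mem hm
  rw [hspan, finrank_span_eq_card hv, Fintype.card_coe]

end Basis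

/-! ### The Hilbert series of the semi-invariant coinvariants -/

theorem qPow_mul_prod_one_add {r : ℕ} (e : Fin r → ℕ) (d : ℕ) (Z : Finset (Fin r)) :
    qPow d * ∏ i ∈ Zᶜ, (1 + zVar * qPow (-(e i : ℤ))) =
      ∑ I ∈ Zᶜ.powerset, PowerSeries.C (HahnSeries.single ((d : ℤ) - ∑ i ∈ I, (e i : ℤ)) (1 : ℤ)) *
        PowerSeries.X ^ I.card := by
  have hq : ∀ I : Finset (Fin r), ∏ i ∈ I, qPow (-(e i : ℤ)) = qPow (-∑ i ∈ I, (e i : ℤ)) := by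
    intro I
    induction I using Finset.cons_induction with
    | empty => simp [qPow]
    | cons a s ha ih =>
      rw [Finset.prod_cons, ih, Finset.sum_cons, qPow, qPow, qPow, ← map_mul,
        HahnSeries.single_mul_single, mul_one, neg_add]
  rw [Finset.prod_one_add, Finset.mul_sum]
  refine Finset.sum_congr rfl fun I _ => ?_
  rw [Finset.prod_mul_distrib, Finset.prod_const, hq, mul_left_comm, qPow, qPow, ← map_mul,
    HahnSeries.single_mul_single, mul_one, ← sub_eq_add_neg, mul_comm, zVar]

/-- The Hilbert series of the `χ`-component of the coinvariants, for any family `ω` of homogeneous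
invariants of `S(V*) ⊗ M` whose Jacobian divides `Δ_χ`. The indices in `Z`, whose `ω i` may have
degree zero, do not contribute: for each of them the coinvariant ideal contains a dual one-form. -/
theorem semiHilb_eq_of_jacobian_dvd [Finite G] [CharZero F] {ρ : Representation F G V}
    {σ : Representation F G M} {χ : G →* Fˣ} {r : ℕ} (b : Module.Basis (Fin r) F M)
    {ω : Fin r → Poly F V ⊗[F] M} {e : Fin r → ℕ} {Δ : Poly F V} {d : ℕ}
    (hω : ∀ i, IsInvariantTensor ρ σ (ω i)) (hdeg : ∀ i, ω i ∈ derPart F V M (e i))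
    (hΔ : IsVandermondian ρ χ Δ d) (hdvd : jacobian b ω ∣ Δ)
    (Z : Finset (Fin r)) (he : ∀ i ∉ Z, 0 < e i)
    (hZ : ∀ k ∈ Z, ∃ θ ∈ formsPart F V M 0 1, (∀ g, formsAct ρ σ g θ = θ) ∧
      ∀ l, contr (ω l) θ = if l = k then 1 else 0) :
    semiHilb ρ σ χ = qPow d * ∏ i ∈ Zᶜ, (1 + zVar * qPow (-(e i : ℤ))) := by
  have hJ : jacobian b ω ≠ 0 := ne_zero_of_dvd_ne_zero hΔ.ne_zero hdvd
  obtain ⟨β, hβdeg, hβ⟩ := exists_frame b hdeg hΔ.ne_zero hΔ.homogeneous hdvd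
  have hZ' : ∀ I, ∀ k ∈ Z, k ∈ I → β I ∈ coinvariantSubspace ρ σ := by
    intro I k hk hkI
    obtain ⟨θ, hθ, hinv, hθω⟩ := hZ k hk
    exact frame_mem_coinvariantSubspace b hJ hβ ⟨⟨0, 1, one_pos, hθ⟩, hinv⟩ hθ hθω hkI
  have hdim := finrank_semi_inf_part b hω hdeg hJ hΔ hβdeg hβ he hZ'
  rw [qPow_mul_prod_one_add, semiHilb, hilbertSeries]
  ext1 j
  rw [PowerSeries.coeff_mk, map_sum]
  simp_rw [hdim]
  have hps : (PowerSeries.mk fun i => ((frameIndex e d Z i j).card : ℤ)) =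
      ∑ I ∈ Zᶜ.powerset, if I.card = j then PowerSeries.X ^ (d - ∑ i ∈ I, e i) else 0 := by
    ext i
    rw [PowerSeries.coeff_mk, map_sum, frameIndex, Finset.card_filter, Nat.cast_sum]
    refine Finset.sum_congr rfl fun I _ => ?_
    obtain ⟨k, hk, -⟩ := hβdeg I
    by_cases hI : I.card = j
    · rw [if_pos hI, PowerSeries.coeff_X_pow]
      have : (I.card = j ∧ i + ∑ k ∈ I, e k = d) ↔ i = d - ∑ i ∈ I, e i := by omega
      simp only [this, Nat.cast_ite, Nat.cast_one, Nat.cast_zero]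
    · simp [hI]
  rw [hps, map_sum]
  refine Finset.sum_congr rfl fun I _ => ?_
  obtain ⟨k, hk, -⟩ := hβdeg I
  rw [PowerSeries.coeff_C_mul, PowerSeries.coeff_X_pow]
  by_cases hI : I.card = j
  · rw [if_pos hI, if_pos hI.symm, HahnSeries.ofPowerSeries_X_pow, mul_one]
    rw [Nat.cast_sub (by omega), Nat.cast_sum]
  · rw [if_neg hI, if_neg (Ne.symm hI), map_zero, mul_zero]

/-- An invariant of degree zero in `S(V*) ⊗ M` has the form `1 ⊗ m` with `m` in `M^G`. -/
theorem pos_of_invariants_eq_bot {ρ : Representation F G V} {σ : Representation F G M}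
    (hσ : σ.invariants = ⊥) {θ : Poly F V ⊗[F] M} {e : ℕ} (hθ : θ ∈ derPart F V M e)
    (hinv : IsInvariantTensor ρ σ θ) (hθ0 : θ ≠ 0) : 0 < e := by
  rcases Nat.eq_zero_or_pos e with rfl | he
  swap
  · exact he
  exfalso
  apply hθ0
  obtain ⟨m, rfl⟩ : ∃ m, (1 : Poly F V) ⊗ₜ[F] m = θ := by
    suffices h : derPart F V M 0 ≤ LinearMap.range (TensorProduct.mk F (Poly F V) M 1) from h hθ
    refine Submodule.map₂_le.2 fun p hp m _ => ?_
    rw [polyPart, pow_zero, Submodule.mem_one] at hp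
    obtain ⟨c, rfl⟩ := hp
    refine ⟨c • m, ?_⟩
    rw [TensorProduct.mk_apply, TensorProduct.mk_apply, Algebra.algebraMap_eq_smul_one,
      TensorProduct.smul_tmul]
  have hinj : Function.Injective fun m : M => (1 : Poly F V) ⊗ₜ[F] m :=
    Function.LeftInverse.injective (g := fun t => TensorProduct.lid F M
      (TensorProduct.map SymmetricAlgebra.algebraMapInv.toLinearMap LinearMap.id t))
      fun m => by simp
  have hm : m ∈ σ.invariants := by
    intro g
    refine hinj ?_
    simpa using hinv g
  rw [hσ, Submodule.mem_bot] at hm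
  rw [hm, TensorProduct.tmul_zero]

theorem ne_zero_of_jacobian_ne_zero {r : ℕ} (b : Module.Basis (Fin r) F M)
    {ω : Fin r → Poly F V ⊗[F] M} (hJ : jacobian b ω ≠ 0) (i : Fin r) : ω i ≠ 0 := by
  intro h
  refine hJ (Matrix.det_eq_zero_of_row_eq_zero i fun j => ?_)
  simp [h]

/-! ### Alternating polynomials -/

section Alternating

theorem prod_dvd_of_prime {R ι : Type*} [CommMonoidWithZero R] {s : Finset ι} {f : ι → R} {z : R}
    (hp : ∀ i ∈ s, Prime (f i)) (hf : ∀ i ∈ s, ∀ j ∈ s, i ≠ j → ¬ f i ∣ f j)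
    (hz : ∀ i ∈ s, f i ∣ z) : ∏ i ∈ s, f i ∣ z := by
  induction s using Finset.cons_induction with
  | empty => simp
  | cons a s ha ih =>
    obtain ⟨c, rfl⟩ := ih (fun i hi => hp i (Finset.mem_cons_of_mem hi))
      (fun i hi j hj => hf i (Finset.mem_cons_of_mem hi) j (Finset.mem_cons_of_mem hj))
      (fun i hi => hz i (Finset.mem_cons_of_mem hi))
    have hpa := hp a (Finset.mem_cons_self a s)
    rw [Finset.prod_cons, mul_comm]
    refine mul_dvd_mul_left _ ((hpa.dvd_or_dvd (hz a (Finset.mem_cons_self a s))).resolve_left ?_)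
    rw [hpa.dvd_finsetProd_iff]
    rintro ⟨j, hj, hdvd⟩
    exact hf a (Finset.mem_cons_self a s) j (Finset.mem_cons_of_mem hj)
      (by rintro rfl; exact ha hj) hdvd

theorem prime_ι {V : Type*} [AddCommGroup V] [Module F V] {α : Module.Dual F V} (hα : α ≠ 0) :
    Prime (SymmetricAlgebra.ι F (Module.Dual F V) α) := by
  have hs : LinearIndepOn F id ({α} : Set (Module.Dual F V)) := LinearIndepOn.singleton hα
  let B := Module.Basis.extend hs
  let k : hs.extend (Set.subset_univ _) := ⟨α, Module.Basis.subset_extend hs rfl⟩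
  have hk : B k = α := by simp [B, k]
  have hprime : Prime (SymmetricAlgebra.ι F (Module.Dual F V) (B k)) := by
    rw [← MulEquiv.prime_iff (SymmetricAlgebra.equivMvPolynomial B),
      SymmetricAlgebra.equivMvPolynomial_ι_apply]
    exact MvPolynomial.X_prime
  rwa [hk] at hprime

/-- Evaluation of polynomial functions at a vector. -/
def evalAt {V : Type*} [AddCommGroup V] [Module F V] (v : V) : Poly F V →ₐ[F] F :=
  SymmetricAlgebra.lift (Module.Dual.eval F V v)

theorem evalAt_ι {V : Type*} [AddCommGroup V] [Module F V] (v : V) (α : Module.Dual F V) :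
    evalAt v (SymmetricAlgebra.ι F _ α) = α v := by
  simp [evalAt]

variable (F) in
/-- The coordinate function `x_i` on `F^n`. -/
def coordPoly (n : ℕ) (i : Fin n) : Poly F (Fin n → F) :=
  SymmetricAlgebra.ι F _ (LinearMap.proj i)

variable (F) in
/-- The Vandermonde determinant in the coordinate functions. -/
def vandermondePoly (n : ℕ) : Poly F (Fin n → F) := (Matrix.vandermonde (coordPoly F n)).det

variable {n : ℕ}

theorem evalAt_coordPoly (v : Fin n → F) (i : Fin n) : evalAt v (coordPoly F n i) = v i := by
  rw [coordPoly, evalAt_ι, LinearMap.proj_apply]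

theorem polyAct_coordPoly (s : Equiv.Perm (Fin n)) (i : Fin n) :
    polyAct (permRep F n) s (coordPoly F n i) = coordPoly F n (s i) := by
  rw [coordPoly, coordPoly, polyAct_ι]
  congr 1

theorem permRep_single (s : Equiv.Perm (Fin n)) (i : Fin n) :
    permRep F n s (Pi.single i 1) = Pi.single (s i) 1 := by
  ext j
  change (Pi.single i 1 : Fin n → F) (s⁻¹ j) = _
  rw [Pi.single_apply, Pi.single_apply]
  simp only [Equiv.Perm.inv_eq_iff_eq]

theorem coordPoly_mem (i : Fin n) : coordPoly F n i ∈ polyPart F (Fin n → F) 1 := by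
  rw [polyPart, pow_one]; exact LinearMap.mem_range_self _ _

theorem coordPoly_pow_mem (i : Fin n) (k : ℕ) :
    coordPoly F n i ^ k ∈ polyPart F (Fin n → F) k := by
  have := Submodule.pow_mem_pow _ (coordPoly_mem (F := F) i) k
  rwa [polyPart, pow_one] at this

theorem coordPoly_injective : Function.Injective (coordPoly F n) := by
  intro i j h
  by_contra hij
  have := congrArg (evalAt (Pi.single i 1)) h
  simp [evalAt_coordPoly, Ne.symm hij] at this

theorem signChar_apply (s : Equiv.Perm (Fin n)) :
    (signChar F n s : F) = ((Equiv.Perm.sign s : ℤ) : F) := by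
  simp [signChar]

theorem polyAct_vandermondePoly (s : Equiv.Perm (Fin n)) :
    polyAct (permRep F n) s (vandermondePoly F n) =
      (signChar F n s : F) • vandermondePoly F n := by
  rw [vandermondePoly, AlgHom.map_det, signChar_apply, Algebra.smul_def, map_intCast,
    ← Matrix.det_permute s]
  congr 1
  ext i j
  simp [Matrix.vandermonde_apply, polyAct_coordPoly]

theorem vandermondePoly_ne_zero : vandermondePoly F n ≠ 0 :=
  Matrix.det_vandermonde_ne_zero_iff.2 coordPoly_injective

theorem prod_mem_polyPart {V ι : Type*} [AddCommGroup V] [Module F V] (s : Finset ι)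
    {f : ι → Poly F V} {k : ι → ℕ} (h : ∀ i ∈ s, f i ∈ polyPart F V (k i)) :
    ∏ i ∈ s, f i ∈ polyPart F V (∑ i ∈ s, k i) := by
  induction s using Finset.cons_induction with
  | empty => simp [polyPart]
  | cons a s ha ih =>
    rw [Finset.prod_cons, Finset.sum_cons]
    exact mul_mem_polyPart (h a (Finset.mem_cons_self a s))
      (ih fun i hi => h i (Finset.mem_cons_of_mem hi))

theorem vandermondePoly_mem :
    vandermondePoly F n ∈ polyPart F (Fin n → F) (∑ i : Fin n, (i : ℕ)) := by
  rw [vandermondePoly, Matrix.det_apply]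
  refine Submodule.sum_mem _ fun s _ => ?_
  rw [Units.smul_def]
  exact zsmul_mem (prod_mem_polyPart _ fun i _ => coordPoly_pow_mem _ _) _

/-- An element negated by the transposition of `i` and `j` is divisible by `x_j - x_i`, because
that transposition acts trivially modulo `x_j - x_i`. -/
theorem sub_dvd_of_swap [CharZero F] {i j : Fin n} {f : Poly F (Fin n → F)}
    (hf : polyAct (permRep F n) (Equiv.swap i j) f = - f) :
    coordPoly F n j - coordPoly F n i ∣ f := by
  rw [← Ideal.mem_span_singleton]
  set I := Ideal.span {coordPoly F n j - coordPoly F n i} with hI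
  have key : (Ideal.Quotient.mkₐ F I).comp (polyAct (permRep F n) (Equiv.swap i j)) =
      Ideal.Quotient.mkₐ F I := by
    refine SymmetricAlgebra.algHom_ext (LinearMap.ext fun α => ?_)
    change Ideal.Quotient.mk I (polyAct _ _ (SymmetricAlgebra.ι F _ α)) =
      Ideal.Quotient.mk I (SymmetricAlgebra.ι F _ α)
    rw [polyAct_ι, Ideal.Quotient.eq, ← map_sub]
    have : (permRep F n).dual (Equiv.swap i j) α - α = (α (Pi.single i 1) - α (Pi.single j 1)) •
        ((LinearMap.proj j : Module.Dual F (Fin n → F)) - LinearMap.proj i) := by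
      refine (Pi.basisFun F (Fin n)).ext fun k => ?_
      have hk : (permRep F n).dual (Equiv.swap i j) α (Pi.single k 1) =
          α (Pi.single (Equiv.swap i j k) 1) := by
        rw [← permRep_single, ← Equiv.swap_inv]
        rfl
      rw [Pi.basisFun_apply, LinearMap.sub_apply, hk]
      simp only [LinearMap.smul_apply, LinearMap.sub_apply, LinearMap.proj_apply, smul_eq_mul]
      rcases eq_or_ne k i with rfl | hki
      · rcases eq_or_ne k j with rfl | hkj
        · simp
        · simp [hkj]
      · rcases eq_or_ne k j with rfl | hkj
        · simp [hki]
        · simp [Equiv.swap_apply_of_ne_of_ne hki hkj, hki.symm, hkj.symm]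
    rw [this, map_smul, map_sub]
    exact Submodule.smul_of_tower_mem _ _ (Ideal.mem_span_singleton_self _)
  have h := DFunLike.congr_fun key f
  change Ideal.Quotient.mk I (polyAct _ _ f) = Ideal.Quotient.mk I f at h
  rw [hf, Ideal.Quotient.eq, ← neg_add', ← two_smul F, neg_mem_iff] at h
  have := Submodule.smul_of_tower_mem I (2 : F)⁻¹ h
  rwa [smul_smul, inv_mul_cancel₀ two_ne_zero, one_smul] at this

theorem vandermondePoly_dvd [CharZero F] {f : Poly F (Fin n → F)}
    (hf : ∀ s, polyAct (permRep F n) s f = (signChar F n s : F) • f) :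
    vandermondePoly F n ∣ f := by
  rw [vandermondePoly, Matrix.det_vandermonde, Finset.prod_sigma']
  refine prod_dvd_of_prime ?_ ?_ ?_
  · rintro ⟨i, j⟩ hij
    rw [Finset.mem_sigma, Finset.mem_Ioi] at hij
    rw [coordPoly, coordPoly, ← map_sub]
    refine prime_ι fun h => ?_
    have := LinearMap.congr_fun h (Pi.single j 1)
    simp [hij.2.ne] at this
  · rintro ⟨i, j⟩ hij ⟨k, l⟩ hkl hne ⟨c, hc⟩
    rw [Finset.mem_sigma, Finset.mem_Ioi] at hij hkl
    dsimp only at hij hkl hc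
    -- a point with `x_i = x_j` and `x_k ≠ x_l`
    have hpt : ∃ v : Fin n → F, v i = v j ∧ v k ≠ v l := by
      by_cases hk : k = i ∨ k = j
      · have hl : l ≠ i ∧ l ≠ j := by
          refine ⟨?_, ?_⟩ <;> rintro rfl <;> rcases hk with rfl | rfl <;> simp_all
          exact absurd hkl hij.le.not_gt
        exact ⟨Pi.single l 1, by simp [hl.1.symm, hl.2.symm], by simp [hkl.2.ne]⟩
      · rw [not_or] at hk
        exact ⟨Pi.single k 1, by simp [Ne.symm hk.1, Ne.symm hk.2], by simp [hkl.2.ne']⟩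
    obtain ⟨v, hv, hv'⟩ := hpt
    have := congrArg (evalAt v) hc
    simp only [map_mul, map_sub, evalAt_coordPoly, hv, sub_self, zero_mul] at this
    exact hv' (sub_eq_zero.1 this).symm
  · rintro ⟨i, j⟩ hij
    rw [Finset.mem_sigma, Finset.mem_Ioi] at hij
    refine sub_dvd_of_swap ?_
    rw [hf, signChar_apply, Equiv.Perm.sign_swap hij.2.ne]
    simp

/-- The Vandermonde determinant generates the alternating polynomials. -/
theorem isVandermondian_vandermondePoly [CharZero F] :
    IsVandermondian (permRep F n) (signChar F n) (vandermondePoly F n) (∑ i : Fin n, (i : ℕ)) := by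
  refine ⟨vandermondePoly_ne_zero, vandermondePoly_mem, fun f => ⟨fun hf => ?_, ?_⟩⟩
  · obtain ⟨h, rfl⟩ := vandermondePoly_dvd hf
    refine ⟨h, (mem_polyInvariants _).2 fun s => ?_, mul_comm _ _⟩
    have := hf s
    rw [map_mul, polyAct_vandermondePoly, ← smul_mul_assoc] at this
    refine mul_left_cancel₀ (smul_ne_zero (Units.ne_zero _) vandermondePoly_ne_zero) this
  · rintro ⟨h, hh, rfl⟩ s
    rw [map_mul, (mem_polyInvariants _).1 hh, polyAct_vandermondePoly, mul_smul_comm]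

end Alternating

/-! ### Invariant derivations of the symmetric group -/

section SymmetricGroup

variable (F) (m : ℕ)

/-- The power `x_i^k` minus the mean of the `k`-th powers of the coordinates for `k > 0`, and `1`
for `k = 0`. -/
def centeredPower (i k : Fin (m + 1)) : Poly F (Fin (m + 1) → F) :=
  coordPoly F (m + 1) i ^ (k : ℕ) -
    if k = 0 then 0 else ((m + 1 : ℕ) : F)⁻¹ • ∑ l, coordPoly F (m + 1) l ^ (k : ℕ)

variable {F m}

theorem polyAct_centeredPower (s : Equiv.Perm (Fin (m + 1))) (i k : Fin (m + 1)) :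
    polyAct (permRep F (m + 1)) s (centeredPower F m i k) = centeredPower F m (s i) k := by
  rw [centeredPower, centeredPower, map_sub, map_pow, polyAct_coordPoly]
  split_ifs
  · rw [map_zero]
  · rw [map_smul, map_sum]
    simp_rw [map_pow, polyAct_coordPoly]
    rw [Equiv.sum_comp s fun l => coordPoly F (m + 1) l ^ (k : ℕ)]

theorem centeredPower_mem (i k : Fin (m + 1)) :
    centeredPower F m i k ∈ polyPart F (Fin (m + 1) → F) k := by
  refine sub_mem (coordPoly_pow_mem i k) ?_
  split_ifs
  · exact zero_mem _
  · exact Submodule.smul_mem _ _ (Submodule.sum_mem _ fun l _ => coordPoly_pow_mem l k)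

theorem centeredPower_zero (i : Fin (m + 1)) : centeredPower F m i 0 = 1 := by
  simp [centeredPower]

theorem sum_centeredPower [CharZero F] (k : Fin (m + 1)) :
    ∑ i, centeredPower F m i k = if k = 0 then ((m + 1 : ℕ) : Poly F (Fin (m + 1) → F)) else 0 := by
  split_ifs with hk
  · subst hk
    simp [centeredPower_zero]
  · simp only [centeredPower, if_neg hk]
    rw [Finset.sum_sub_distrib, Finset.sum_const, Finset.card_univ, Fintype.card_fin,
      ← Nat.cast_smul_eq_nsmul F, smul_smul, mul_inv_cancel₀ (Nat.cast_ne_zero.2 (by omega)),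
      one_smul, sub_self]

theorem det_centeredPower :
    (Matrix.of fun k i => centeredPower F m i k).det = vandermondePoly F (m + 1) := by
  rw [vandermondePoly, ← Matrix.det_transpose]
  rw [← Matrix.det_transpose (Matrix.vandermonde _), ← Matrix.det_transpose]
  refine Matrix.det_eq_of_forall_row_eq_smul_add_const
    (fun k => - if k = 0 then 0 else ((m + 1 : ℕ) : F)⁻¹ • ∑ l, coordPoly F (m + 1) l ^ (k : ℕ)) 0
    (by simp) fun k i => ?_
  simp [centeredPower, sub_eq_add_neg]

/-- The minor of the matrix of centered powers belonging to positive powers divides the Vandermonde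
determinant: adding up all the rows of the matrix gives `(m + 1, 0, …, 0)`. -/
theorem det_centeredPower_succ_dvd [CharZero F] :
    (Matrix.of fun k i : Fin m => centeredPower F m i.succ k.succ).det ∣
      vandermondePoly F (m + 1) := by
  set B : Matrix (Fin (m + 1)) (Fin (m + 1)) (Poly F (Fin (m + 1) → F)) :=
    Matrix.of fun i k => centeredPower F m i k with hB
  have hdet : B.det = vandermondePoly F (m + 1) := by
    rw [← det_centeredPower, ← Matrix.det_transpose]; rfl
  have h := Matrix.det_updateRow_sum B 0 fun _ => 1
  rw [one_smul, hdet, Matrix.det_succ_row_zero] at h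
  have hrow : ∀ k, B.updateRow 0 (∑ i, (1 : Poly F (Fin (m + 1) → F)) • B i) 0 k =
      if k = 0 then ((m + 1 : ℕ) : Poly F (Fin (m + 1) → F)) else 0 := by
    intro k
    rw [Matrix.updateRow_self, ← sum_centeredPower, Finset.sum_apply]
    simp [hB]
  rw [Finset.sum_eq_single 0 (fun k _ hk => by rw [hrow, if_neg hk, mul_zero, zero_mul])
    (by simp), hrow, if_pos rfl] at h
  rw [← h, ← Matrix.det_transpose]
  refine Dvd.intro_left _ (congrArg _ (congrArg _ ?_))
  ext k i
  simp [hB]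

variable (F m) in
/-- The invariant derivations `∑ (x_i^k - mean) ⊗ e_i` of the permutation representation. -/
def permDeriv (k : Fin (m + 1)) : Poly F (Fin (m + 1) → F) ⊗[F] (Fin (m + 1) → F) :=
  ∑ i, centeredPower F m i k ⊗ₜ Pi.single i 1

theorem permDeriv_mem (k : Fin (m + 1)) :
    permDeriv F m k ∈ derPart F (Fin (m + 1) → F) (Fin (m + 1) → F) k :=
  Submodule.sum_mem _ fun i _ => Submodule.apply_mem_map₂ _ (centeredPower_mem i k) trivial

theorem permDeriv_invariant (k : Fin (m + 1)) :
    IsInvariantTensor (permRep F (m + 1)) (permRep F (m + 1)) (permDeriv F m k) := by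
  intro s
  rw [permDeriv, map_sum]
  simp_rw [TensorProduct.map_tmul, AlgHom.toLinearMap_apply, polyAct_centeredPower, permRep_single]
  exact Equiv.sum_comp s fun i => centeredPower F m i k ⊗ₜ[F] (Pi.single i 1 : Fin (m + 1) → F)

theorem jacobian_permDeriv :
    jacobian (Pi.basisFun F (Fin (m + 1))) (permDeriv F m) = vandermondePoly F (m + 1) := by
  rw [← det_centeredPower, jacobian]
  congr 1
  ext k i
  simp only [Matrix.of_apply, permDeriv, map_sum, Finsupp.finsetSum_apply]
  rw [Finset.sum_eq_single i]
  · simp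
  · intro j _ hj
    simp [hj]
  · simp

variable (F m) in
/-- The one-form `(θ_1 + ⋯ + θ_n) / n`. -/
def meanForm : Forms F (Fin (m + 1) → F) (Fin (m + 1) → F) :=
  ((m + 1 : ℕ) : F)⁻¹ • ∑ i : Fin (m + 1), 1 ⊗ₜ ExteriorAlgebra.ι F (LinearMap.proj i)

theorem meanForm_mem : meanForm F m ∈ formsPart F (Fin (m + 1) → F) (Fin (m + 1) → F) 0 1 := by
  refine Submodule.smul_mem _ _ (Submodule.sum_mem _ fun i _ => tmul_mem_formsPart ?_ ?_)
  · rw [polyPart, pow_zero]; exact Submodule.one_le.1 le_rfl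
  · rw [ExteriorAlgebra.exteriorPower, pow_one]; exact LinearMap.mem_range_self _ _

theorem formsAct_meanForm (s : Equiv.Perm (Fin (m + 1))) :
    formsAct (permRep F (m + 1)) (permRep F (m + 1)) s (meanForm F m) = meanForm F m := by
  have hdual : ∀ i, (permRep F (m + 1)).dual s (LinearMap.proj i) = LinearMap.proj (s i) := by
    intro i
    rfl
  rw [meanForm, map_smul, map_sum]
  simp_rw [formsAct_tmul, map_one, ExteriorAlgebra.map_apply_ι, hdual]
  congr 1
  exact Equiv.sum_comp s fun i => (1 : Poly F (Fin (m + 1) → F)) ⊗ₜ[F]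
    ExteriorAlgebra.ι F (LinearMap.proj i : Module.Dual F (Fin (m + 1) → F))

theorem contr_permDeriv_meanForm [CharZero F] (k : Fin (m + 1)) :
    contr (permDeriv F m k) (meanForm F m) = if k = 0 then 1 else 0 := by
  have hterm : ∀ i l : Fin (m + 1), contr (centeredPower F m i k ⊗ₜ[F] Pi.single i (1 : F))
      (1 ⊗ₜ ExteriorAlgebra.ι F (LinearMap.proj l)) =
        if l = i then centeredPower F m i k • (1 : Forms F (Fin (m + 1) → F) (Fin (m + 1) → F))
        else 0 := by
    intro i l
    rw [contr_tmul, mul_one, CliffordAlgebra.contractLeft_ι]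
    split_ifs with h
    · subst h
      simp [Algebra.TensorProduct.one_def, TensorProduct.smul_tmul']
    · simp [h]
  rw [meanForm, LinearMap.map_smul_of_tower, permDeriv, map_sum]
  simp_rw [map_sum, LinearMap.sum_apply, hterm]
  simp only [Finset.sum_ite_eq, Finset.mem_univ, if_true]
  rw [← Finset.sum_smul, sum_centeredPower]
  split_ifs
  · rw [Nat.cast_smul_eq_nsmul, ← Nat.cast_smul_eq_nsmul F, smul_smul,
      inv_mul_cancel₀ (Nat.cast_ne_zero.2 (by omega)), one_smul]
  · rw [zero_smul, smul_zero]

/-- The basis `e_{i+1} - e_0` of the space of vectors with coordinate sum zero. -/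
def sumZeroBasis : Module.Basis (Fin m) F (sumZero F (m + 1)) :=
  Module.Basis.ofEquivFun
    { toFun := fun v i => v.1 i.succ
      invFun := fun u => ⟨Fin.cons (-∑ i, u i) u, by
        simp [sumZero, Fin.sum_univ_succ]⟩
      map_add' := fun _ _ => rfl
      map_smul' := fun _ _ => rfl
      left_inv := fun v => by
        have hv : v.1 0 + ∑ i : Fin m, v.1 i.succ = 0 := by
          simpa [sumZero, Fin.sum_univ_succ] using v.2
        ext i
        refine Fin.cases ?_ (fun i => ?_) i
        · exact (eq_neg_of_add_eq_zero_left hv).symm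
        · rfl
      right_inv := fun u => rfl }

theorem coe_sumZeroBasis (i : Fin m) :
    (sumZeroBasis (F := F) i : Fin (m + 1) → F) = Pi.single i.succ 1 - Pi.single 0 1 := by
  have h : (sumZeroBasis (F := F) i : Fin (m + 1) → F) =
      Fin.cons (-∑ k, (Pi.single i 1 : Fin m → F) k) (Pi.single i 1) := by
    rw [sumZeroBasis, Module.Basis.coe_ofEquivFun]; rfl
  rw [h]
  ext j
  refine Fin.cases ?_ (fun j => ?_) j
  · simp
  · simp [Pi.single_apply]

variable (F m) in
/-- The invariant derivations of positive degree of the standard representation. -/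
def standardDeriv (k : Fin m) : Poly F (Fin (m + 1) → F) ⊗[F] sumZero F (m + 1) :=
  ∑ i : Fin m, centeredPower F m i.succ k.succ ⊗ₜ sumZeroBasis i

theorem standardDeriv_mem (k : Fin m) :
    standardDeriv F m k ∈ derPart F (Fin (m + 1) → F) (sumZero F (m + 1)) (k + 1) :=
  Submodule.sum_mem _ fun i _ => Submodule.apply_mem_map₂ _ (centeredPower_mem i.succ k.succ) trivial

theorem lTensor_standardDeriv [CharZero F] (k : Fin m) :
    (sumZero F (m + 1)).subtype.lTensor (Poly F (Fin (m + 1) → F)) (standardDeriv F m k) =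
      permDeriv F m k.succ := by
  have h := sum_centeredPower (F := F) k.succ
  rw [if_neg (Fin.succ_ne_zero k), Fin.sum_univ_succ] at h
  rw [standardDeriv, permDeriv, Fin.sum_univ_succ, map_sum, eq_neg_of_add_eq_zero_left h]
  simp_rw [LinearMap.lTensor_tmul, Submodule.subtype_apply, coe_sumZeroBasis, TensorProduct.tmul_sub]
  rw [Finset.sum_sub_distrib, ← TensorProduct.sum_tmul, TensorProduct.neg_tmul]
  abel

theorem standardDeriv_invariant [CharZero F] (k : Fin m) :
    IsInvariantTensor (permRep F (m + 1)) (standardRep F (m + 1)) (standardDeriv F m k) := by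
  intro s
  refine Module.Flat.lTensor_preserves_injective_linearMap
    (M := Poly F (Fin (m + 1) → F)) (sumZero F (m + 1)).subtype Subtype.val_injective ?_
  rw [lTensor_standardDeriv]
  conv_rhs => rw [← permDeriv_invariant k.succ s, ← lTensor_standardDeriv]
  simp only [LinearMap.lTensor, ← LinearMap.comp_apply, ← TensorProduct.map_comp]
  rfl

theorem jacobian_standardDeriv :
    jacobian sumZeroBasis (standardDeriv F m) =
      (Matrix.of fun k i : Fin m => centeredPower F m i.succ k.succ).det := by
  rw [jacobian]
  congr 1
  ext k i
  simp only [Matrix.of_apply, standardDeriv, map_sum, Finsupp.finsetSum_apply]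
  rw [Finset.sum_eq_single i]
  · simp
  · intro j _ hj
    simp [hj]
  · simp

theorem qPow_sum {ι : Type*} (s : Finset ι) (e : ι → ℕ) :
    qPow (∑ i ∈ s, e i : ℕ) = ∏ i ∈ s, qPow (e i) := by
  induction s using Finset.cons_induction with
  | empty => simp [qPow]
  | cons a s ha ih =>
    rw [Finset.prod_cons, ← ih, Finset.sum_cons, qPow, qPow, qPow, ← map_mul,
      HahnSeries.single_mul_single, mul_one, Nat.cast_add]

theorem qPow_sum_mul_prod (m : ℕ) :
    qPow (∑ i : Fin (m + 1), (i : ℕ) : ℕ) * ∏ k : Fin m, (1 + zVar * qPow (-((k : ℕ) + 1 : ℕ) : ℤ)) =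
      ∏ i ∈ Finset.Icc 1 m, (qPow i + zVar) := by
  have hIcc : ∏ i ∈ Finset.Icc 1 m, (qPow i + zVar) =
      ∏ k : Fin m, (qPow ((k : ℕ) + 1 : ℕ) + zVar) := by
    rw [Fin.prod_univ_eq_prod_range (fun k => qPow (k + 1 : ℕ) + zVar),
      ← Finset.Ico_add_one_right_eq_Icc, Finset.prod_Ico_eq_prod_range]
    simp [add_comm]
  rw [hIcc, Fin.sum_univ_succ, Fin.val_zero, zero_add, qPow_sum, ← Finset.prod_mul_distrib]
  refine Finset.prod_congr rfl fun k _ => ?_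
  have hcancel : qPow ((k : ℕ) + 1 : ℕ) * qPow (-((k : ℕ) + 1 : ℕ) : ℤ) = 1 := by
    rw [qPow, qPow, ← map_mul, HahnSeries.single_mul_single, add_neg_cancel, mul_one]
    exact map_one _
  rw [mul_add, mul_one, mul_left_comm, Fin.val_succ, hcancel, mul_one]

theorem semiHilb_standardRep [CharZero F] :
    semiHilb (permRep F (m + 1)) (standardRep F (m + 1)) (signChar F (m + 1)) =
      ∏ i ∈ Finset.Icc 1 m, (qPow i + zVar) := by
  rw [semiHilb_eq_of_jacobian_dvd sumZeroBasis standardDeriv_invariant standardDeriv_mem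
    isVandermondian_vandermondePoly (by
      rw [jacobian_standardDeriv]; exact det_centeredPower_succ_dvd) ∅
    (fun i _ => Nat.succ_pos i) (by simp), ← qPow_sum_mul_prod]
  simp

theorem semiHilb_permRep [CharZero F] :
    semiHilb (permRep F (m + 1)) (permRep F (m + 1)) (signChar F (m + 1)) =
      ∏ i ∈ Finset.Icc 1 m, (qPow i + zVar) := by
  rw [semiHilb_eq_of_jacobian_dvd (Pi.basisFun F (Fin (m + 1))) permDeriv_invariant permDeriv_mem
    isVandermondian_vandermondePoly (dvd_of_eq jacobian_permDeriv) {0}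
    (fun i hi => by simpa [Nat.pos_iff_ne_zero] using hi)
    (fun k hk => ⟨meanForm F m, meanForm_mem, formsAct_meanForm, fun l => by
      rw [Finset.mem_singleton.1 hk]; exact contr_permDeriv_meanForm l⟩), ← qPow_sum_mul_prod,
    ← Fin.image_succ_univ, Finset.prod_image (fun _ _ _ _ h => Fin.succ_injective _ h)]
  simp

end SymmetricGroup

end SuperCoinvariant

end

open SuperCoinvariant in
theorem mainTheorem2 (F : Type*) [Field F] [CharZero F] :
    -- a general pseudo-reflection group, with arbitrary choices of the basic derivations `ω` of
    -- `M*` and of the Vandermondian `Δ` of `χ`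
    (∀ (G : Type*) [Group G] (V : Type*) [AddCommGroup V] [Module F V] [FiniteDimensional F V]
        (M : Type*) [AddCommGroup M] [Module F M] [FiniteDimensional F M]
        (ρ : Representation F G V) (σ : Representation F G M) (χ : G →* Fˣ)
        (r : ℕ) (b : Module.Basis (Fin r) F M) (ω : Fin r → Poly F V ⊗[F] M) (e : Fin r → ℕ)
        (Δ : Poly F V) (d : ℕ),
      IsPseudoReflectionGroup ρ →
      IsBasicDerivations ρ σ ω e →
      IsVandermondian ρ χ Δ d →
      jacobian b ω ∣ Δ →
      σ.invariants = ⊥ →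
      semiHilb ρ σ χ = qPow d * ∏ i, (1 + zVar * qPow (-(e i : ℤ)))) ∧
    -- permutation matrices, with `M` the standard representation and `χ` the sign character
    (∀ n : ℕ, 1 ≤ n →
      semiHilb (permRep F n) (standardRep F n) (signChar F n) =
        ∏ i ∈ Finset.Icc 1 (n - 1), (qPow i + zVar)) ∧
    -- the sign component of `F[x_1, …, x_n, θ_1, …, θ_n]` modulo its super coinvariant ideal
    (∀ n : ℕ, 1 ≤ n →
      semiHilb (permRep F n) (permRep F n) (signChar F n) =
        ∏ i ∈ Finset.Icc 1 (n - 1), (qPow i + zVar)) := by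
  refine ⟨?_, ?_, ?_⟩
  · intro G _ V _ _ _ M _ _ _ ρ σ χ r b ω e Δ d hρ hω hΔ hdvd hσ
    have := hρ.finite
    have hJ : jacobian b ω ≠ 0 := ne_zero_of_dvd_ne_zero hΔ.ne_zero hdvd
    rw [semiHilb_eq_of_jacobian_dvd b hω.invariant hω.homogeneous hΔ hdvd ∅
      (fun i _ => pos_of_invariants_eq_bot hσ (hω.homogeneous i) (hω.invariant i)
        (ne_zero_of_jacobian_ne_zero b hJ i)) (by simp), Finset.compl_empty]
  · rintro (_ | m) hn
    · omega
    · exact semiHilb_standardRep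
  · rintro (_ | m) hn
    · omega
    · exact semiHilb_permRep
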